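/- Let $G$ be a finite connected bipartite plane graph (multiple edges allowed), with vertices properly colored black and white and with a fixed embedding in $\mathbb{R}^2$, such that every edge of $G$ lies in some perfect matching, and such that $G$ has at least one perfect matching (this only excludes the graph with one vertex and no edge). Let $\mathcal{D}_G$ be the set of perfect matchings (dimers) of $G$, and let $\mathrm{Faces}(G)$ be the set of bounded connected components of $\mathbb{R}^2\setminus G$. If the boundary of $f\in\mathrm{Faces}(G)$ is a cycle, an edge of it is called black-white in $f$ if, going around $f$ clockwise, one sees first its black and then its white vertex, and white-black in $f$ otherwise. If a dimer $M$ contains all black-white edges of $f$, the down-flip of $M$ at $f$ replaces them with the white-black edges of $f$. Write $M\le M'$ if $M$ is obtained from $M'$ by a (possibly empty) sequence of down-flips. Then $\mathcal{D}_G$ has a unique least element $\hat 0$ for this relation. For a saturated chain $C:\ \hat 0=M_0\lessdot M_1\lessdot\dots\lessdot M_\ell=M$ in $\mathcal{D}_G$, where $M_{i-1}$ and $M_i$ are related by a flip at the face $f_i$, let $\mathrm{wt}(C)=y_{f_1}\cdots y_{f_\ell}$. Orient the edges of $M\setminus\hat 0$ from black to white and those of $\hat 0\setminus M$ from white to black;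 then $M\triangle\hat 0$ is a disjoint union of directed cycles (and isolated vertices). Define the height vector $\mathrm{ht}(M)\in\mathbb{Z}^{\mathrm{Faces}(G)}$ by $$\mathrm{ht}(M)_f=\sum_{C}-\mathrm{wind}(C,p),$$ where the sum is over these directed cycles $C$, $p$ is any point of $f$ (the value does not depend on it), and $\mathrm{wind}(C,p)$ is the winding number of $C$ around $p$ (counterclockwise is positive). Then for every dimer $M\in\mathcal{D}_G$ all coordinates of $\mathrm{ht}(M)$ are nonnegative, there is a saturated chain from $\hat 0$ to $M$, and every saturated chain $C$ from $\hat 0$ to $M$ has weight $\mathrm{wt}(C)=\mathbf{y}^{\mathrm{ht}(M)}=\prod_f y_f^{\mathrm{ht}(M)_f}$; that is, the multivariate rank $\mathrm{mrk}(M):=\mathrm{wt}(C)$ is well defined and $$\mathrm{mrk}(M)=\mathbf{y}^{\mathrm{ht}(M)}.$$ Moreover, the dimer face polynomial $D_G(\mathbf{y}):=\sum_{M\in\mathcal{D}_G}\mathrm{mrk}(M)$ satisfies $$D_G(\mathbf{y})=\sum_{M\in\mathcal{D}_G}\mathbf{y}^{\mathrm{ht}(M)}.$$ -/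

import Mathlib

/-- A bipartite plane graph with vertex set `V` and edge set `E`: a bipartite graph (multiple edges
allowed) with a fixed proper colouring of its vertices in black and white, together with an
embedding in the plane `ℂ`. Every edge `e` joins a black vertex `black e` to a white vertex
`white e` and is drawn as a simple arc (parametrized from its black to its white end); arcs meet
vertices, and each other, only at their ends. -/
structure BipartitePlaneGraph (V E : Type*) where
  /-- the colouring of the vertices -/
  IsBlack : V → Prop
  /-- the black end of an edge -/
  black : E → V
  /-- the white end of an edge -/
  white : E → V
  isBlack_black : ∀ e, IsBlack (black e)
  not_isBlack_white : ∀ e, ¬ IsBlack (white e)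
  /-- the position of the vertices in the plane -/
  pos : V → ℂ
  pos_injective : Function.Injective pos
  /-- the arc that draws an edge -/
  arc : ∀ e, Path (pos (black e)) (pos (white e))
  arc_injective : ∀ e, Function.Injective (arc e)
  arc_eq_pos : ∀ e t v, arc e t = pos v → t = 0 ∨ t = 1
  arc_eq_arc : ∀ e e' s t, e ≠ e' → arc e s = arc e' t → s = 0 ∨ s = 1

namespace BipartitePlaneGraph

noncomputable section

/-- The total change of the argument of `γ t - p` along the curve `γ`, computed from a continuous
branch of `log (γ - p)` along `γ` (one exists, and the value does not depend on it, if `γ` is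
continuous and does not pass through `p`). -/
def argChange (γ : unitInterval → ℂ) (p : ℂ) : ℝ :=
  open Classical in
  if h : ∃ L : C(unitInterval, ℂ), ∀ t, Complex.exp (L t) = γ t - p then
    (h.choose 1 - h.choose 0).im
  else 0

variable {V E : Type*} (G : BipartitePlaneGraph V E)

/-- The underlying simple graph (parallel edges identified). -/
def toSimpleGraph : SimpleGraph V where
  Adj u v := ∃ e, (G.black e = u ∧ G.white e = v) ∨ (G.black e = v ∧ G.white e = u)
  symm := ⟨fun _ _ ⟨e, h⟩ => ⟨e, h.symm⟩⟩
  loopless := ⟨fun _ ⟨e, h⟩ => G.not_isBlack_white e (by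
    have hb := G.isBlack_black e
    rcases h with ⟨h1, h2⟩ | ⟨h1, h2⟩ <;> rw [h2, ← h1] <;> exact hb)⟩

/-- A perfect matching (dimer): a set of edges that is incident to each vertex exactly once. -/
@[ext]
structure Dimer where
  edges : Finset E
  perfect : ∀ v, ∃! e, e ∈ edges ∧ (G.black e = v ∨ G.white e = v)

instance [Fintype E] : Fintype G.Dimer :=
  Fintype.ofInjective Dimer.edges (fun _ _ h => Dimer.ext h)

/-- Property `(*)` of a finite bipartite plane graph: it is connected and every edge is in some
perfect matching. -/
structure PropertyStar : Prop where
  connected : G.toSimpleGraph.Connected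
  edge_mem_dimer : ∀ e, ∃ M : G.Dimer, e ∈ M.edges

/-- The subset of the plane that `G` occupies. -/
def drawing : Set ℂ := Set.range G.pos ∪ ⋃ e, Set.range (G.arc e)

/-- The non-infinite faces: the bounded connected components of the complement of the drawing. -/
def Face : Type :=
  {F : Set ℂ // (∃ p ∈ G.drawingᶜ, F = connectedComponentIn G.drawingᶜ p) ∧
    Bornology.IsBounded F}

variable {G}

/-- A point in a face. -/
def Face.point (f : G.Face) : ℂ := f.2.1.choose

theorem Face.point_mem (f : G.Face) : f.point ∈ f.1 := by
  have h := f.2.1.choose_spec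
  have h2 : f.point ∈ connectedComponentIn G.drawingᶜ f.point := mem_connectedComponentIn h.1
  exact h.2.symm ▸ h2

variable (G)

/-- `G.IsDirectedCycle P N`: the edges in `P ∪ N` form a cycle (of even length `2 n ≥ 2`) which can
be traversed so that the edges traversed from black to white are those in `P` and the edges
traversed from white to black are those in `N`. The edges in the order of the traversal are
`b 0, w 0, b 1, w 1, …, b (n - 1), w (n - 1)`. The pair `(P, N)` determines the directed cycle,
up to the choice of a starting point. -/
def IsDirectedCycle (P N : Finset E) : Prop :=
  ∃ n : ℕ, 0 < n ∧ ∃ b w : ZMod n → E,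
    (∀ i, G.white (b i) = G.white (w i)) ∧
    (∀ i, G.black (w i) = G.black (b (i + 1))) ∧
    Function.Injective (fun i => G.black (b i)) ∧
    Function.Injective (fun i => G.white (b i)) ∧
    (∀ i, b i ≠ w i) ∧
    (∀ e, e ∈ P ↔ ∃ i, b i = e) ∧
    (∀ e, e ∈ N ↔ ∃ i, w i = e)

/-- A curve that does not pass through `p` has a continuous branch of `log (γ - p)`. -/
theorem exists_branch (γ : unitInterval → ℂ) (hγ : Continuous γ) (p : ℂ) (hp : ∀ t, γ t ≠ p) :
    ∃ L : C(unitInterval, ℂ), ∀ t, Complex.exp (L t) = γ t - p := by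
  have h0 : γ 0 - p ≠ 0 := sub_ne_zero.2 (hp 0)
  let g : C(unitInterval, {z : ℂ // z ≠ 0}) :=
    ⟨fun t => ⟨γ t - p, sub_ne_zero.2 (hp t)⟩, by fun_prop⟩
  obtain ⟨L, hL, -⟩ := Complex.isCoveringMap_exp.exists_path_lifts g (Complex.log (γ 0 - p))
    (by ext; simp [g, Complex.exp_log h0])
  refine ⟨L, fun t => ?_⟩
  have h := congrArg Subtype.val (congrFun hL t)
  exact h

theorem exists_argChange (γ : unitInterval → ℂ) (hγ : Continuous γ) (p : ℂ) (hp : ∀ t, γ t ≠ p) :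
    ∃ c : ℂ, argChange γ p = c.im ∧ Complex.exp c = (γ 1 - p) / (γ 0 - p) := by
  have h := exists_branch γ hγ p hp
  refine ⟨h.choose 1 - h.choose 0, by rw [argChange, dif_pos h], ?_⟩
  rw [Complex.exp_sub, h.choose_spec, h.choose_spec]

/-- The change of argument does not depend on the branch. -/
theorem argChange_eq (γ : unitInterval → ℂ) (p : ℂ) (L : C(unitInterval, ℂ))
    (hL : ∀ t, Complex.exp (L t) = γ t - p) : argChange γ p = (L 1 - L 0).im := by
  have h : ∃ L : C(unitInterval, ℂ), ∀ t, Complex.exp (L t) = γ t - p := ⟨L, hL⟩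
  rw [argChange, dif_pos h]
  set K := h.choose
  have hK : ∀ t, Complex.exp (K t) = γ t - p := h.choose_spec
  have e : (fun t => K t - (K 0 - L 0)) = ⇑L := by
    refine Complex.isCoveringMap_exp.eq_of_comp_eq (by fun_prop) (by fun_prop) ?_ 0 (by simp)
    ext t
    have h0 : Complex.exp (K 0 - L 0) = 1 := by
      rw [Complex.exp_sub, hK, hL, div_self]
      rw [← hL]; exact Complex.exp_ne_zero _
    simp only [Function.comp_apply]
    rw [Complex.exp_sub (K t), h0, hK, hL, div_one]
  have := congrFun e 1
  rw [← this]; simp only [Complex.sub_im]; ring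

/-- The total change of argument along a directed cycle is an integer multiple of `2 π`. -/
theorem exists_int_winding {P N : Finset E} (h : G.IsDirectedCycle P N) (p : ℂ)
    (hp : ∀ e t, G.arc e t ≠ p) :
    ∃ k : ℤ, ∑ e ∈ P, argChange (G.arc e) p - ∑ e ∈ N, argChange (G.arc e) p
      = k * (2 * Real.pi) := by
  classical
  obtain ⟨n, hn, b, w, h1, h2, h3, h4, -, h6, h7⟩ := h
  have : NeZero n := ⟨hn.ne'⟩
  have hb : Function.Injective b := fun i j hij => h3 (by simp [hij])
  have hw : Function.Injective w := fun i j hij => h4 (by simp [h1, hij])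
  have eP : P = Finset.univ.image b := by ext e; simp [h6]
  have eN : N = Finset.univ.image w := by ext e; simp [h7]
  choose c hc hc' using fun e => exists_argChange (G.arc e) (G.arc e).continuous p (hp e)
  have key : Complex.exp (∑ i, (c (b i) - c (w i))) = 1 := by
    have hnb : ∀ e, G.pos (G.black e) - p ≠ 0 := fun e h =>
      hp e 0 (by simpa using sub_eq_zero.1 h)
    have hnw : ∀ e, G.pos (G.white e) - p ≠ 0 := fun e h =>
      hp e 1 (by simpa using sub_eq_zero.1 h)
    have hs : ∏ i, (G.pos (G.black (b (i + 1))) - p) = ∏ i, (G.pos (G.black (b i)) - p) :=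
      Equiv.prod_comp (Equiv.addRight (1 : ZMod n)) (fun i => G.pos (G.black (b i)) - p)
    have hq : ∀ i, Complex.exp (c (b i) - c (w i)) =
        (G.pos (G.black (b (i + 1))) - p) / (G.pos (G.black (b i)) - p) := fun i => by
      rw [Complex.exp_sub, hc', hc']
      simp only [Path.source, Path.target, h1, h2]
      have := hnw (w i)
      have := hnb (b i)
      have := hnb (b (i + 1))
      field_simp
    rw [Complex.exp_sum]
    simp only [hq, Finset.prod_div_distrib, hs]
    exact div_self (Finset.prod_ne_zero_iff.2 fun i _ => hnb _)
  obtain ⟨k, hk⟩ := Complex.exp_eq_one_iff.1 key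
  refine ⟨k, ?_⟩
  rw [eP, eN, Finset.sum_image hb.injOn, Finset.sum_image hw.injOn, ← Finset.sum_sub_distrib]
  have := congrArg Complex.im hk
  simp only [hc]
  simpa using this

/-- The winding number around `p` of the directed cycle `(P, N)`: the total change of argument
divided by `2 π` (the quotient is an integer, see `exists_int_winding`, so that `round` only turns
it into an element of `ℤ`). Counterclockwise is positive. -/
def wind (P N : Finset E) (p : ℂ) : ℤ :=
  round ((∑ e ∈ P, argChange (G.arc e) p - ∑ e ∈ N, argChange (G.arc e) p) / (2 * Real.pi))

variable {G}

/-- The boundary of the face `f` is a cycle and, going around `f` clockwise, `P` is the set of its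
edges that are traversed from black to white (the black-white edges of `f`) and `N` the set of those
traversed from white to black (the white-black edges of `f`). -/
def Face.IsClockwiseBoundary (f : G.Face) (P N : Finset E) : Prop :=
  G.IsDirectedCycle P N ∧
  frontier f.1 = (⋃ e ∈ P, Set.range (G.arc e)) ∪ (⋃ e ∈ N, Set.range (G.arc e)) ∧
  ∀ p ∈ f.1, G.wind P N p = -1

open Classical in
/-- `M'` is obtained from `M` by the down-flip at `f`: `M` contains all black-white edges of `f`,
and they are replaced with the white-black edges of `f`. (The inverse operation is the up-flip.) -/
def DownFlip (f : G.Face) (M M' : G.Dimer) : Prop :=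
  ∃ P N : Finset E, f.IsClockwiseBoundary P N ∧ P ⊆ M.edges ∧ M'.edges = (M.edges \ P) ∪ N

/-- `M ≤ M'` if `M` is obtained from `M'` by a sequence of down-flips. -/
instance : Preorder G.Dimer where
  le M M' := Relation.ReflTransGen (fun A B : G.Dimer => ∃ f, DownFlip f A B) M' M
  le_refl _ := Relation.ReflTransGen.refl
  le_trans _ _ _ h h' := Relation.ReflTransGen.trans h' h

variable (G)

/-- The least element `0̂` of the set of dimers. -/
def zeroHat [Nonempty G.Dimer] : G.Dimer := Classical.epsilon (fun Z : G.Dimer => IsBot Z)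

variable {G}

/-- A saturated chain `A = M₀ ⋖ M₁ ⋖ ⋯ ⋖ M_ℓ = B` of dimers, where `M_{i+1}` and `M_i` are
related by a flip at the face `face i`. -/
structure SaturatedChain (A B : G.Dimer) where
  length : ℕ
  dimer : Fin (length + 1) → G.Dimer
  face : Fin length → G.Face
  dimer_zero : dimer 0 = A
  dimer_last : dimer (Fin.last length) = B
  covBy : ∀ i : Fin length, dimer i.castSucc ⋖ dimer i.succ
  flip : ∀ i : Fin length, DownFlip (face i) (dimer i.succ) (dimer i.castSucc)

/-- The weight of a saturated chain: the product of the variables of the flipped faces. -/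
def SaturatedChain.weight {A B : G.Dimer} (C : SaturatedChain A B) : MvPolynomial G.Face ℤ :=
  ∏ i, MvPolynomial.X (C.face i)

/-- The multivariate rank of `M`: the weight of a saturated chain from `0̂` to `M`. -/
def mrk [Nonempty G.Dimer] (M : G.Dimer) : MvPolynomial G.Face ℤ :=
  open Classical in
  if h : Nonempty (SaturatedChain G.zeroHat M) then h.some.weight else 0

variable (G)

/-- The dimer face polynomial. -/
def dimerFacePolynomial [Fintype E] [Nonempty G.Dimer] : MvPolynomial G.Face ℤ :=
  ∑ M : G.Dimer, mrk M

variable {G}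

open Classical in
/-- The directed cycles of `M △ M₀`, where the edges of `M \ M₀` are oriented from black to white
and the edges of `M₀ \ M` from white to black. -/
def cycles [Fintype E] (M M₀ : G.Dimer) : Finset (Finset E × Finset E) :=
  {C | G.IsDirectedCycle C.1 C.2 ∧ C.1 ⊆ M.edges \ M₀.edges ∧ C.2 ⊆ M₀.edges \ M.edges}

/-- The height of `M` at a point `p` of the plane: minus the sum of the winding numbers around `p`
of the directed cycles of `M △ 0̂`. -/
def heightAt [Fintype E] [Nonempty G.Dimer] (M : G.Dimer) (p : ℂ) : ℤ :=
  ∑ C ∈ cycles M G.zeroHat, -G.wind C.1 C.2 p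

/-- The height vector of `M`; the coordinate at `f` is the height at any point of `f`. -/
def height [Fintype E] [Nonempty G.Dimer] (M : G.Dimer) (f : G.Face) : ℤ :=
  heightAt M f.point

variable (G)

/-- The monomial `y ^ h` in the variables of the faces, for a vector `h` of nonnegative integers
with finitely many nonzero coordinates. -/
def monomialOf (h : G.Face → ℤ) : MvPolynomial G.Face ℤ :=
  ∏ᶠ f, MvPolynomial.X f ^ (h f).toNat

end

end BipartitePlaneGraph

/-!
# Heights and flips of dimers of a plane graph

The edges are oriented from black to white, and a *flow* is a divergence-free rational weight on the
edges, that is, an element of the cycle space; the difference of two dimers is a flow. A flow has a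
winding number around each point off the drawing. This number is constant on the faces and zero on
the unbounded components, and it is linear in the flow. The height of `M` is minus the winding number
of `M - 0̂`, since the cycles of `M △ 0̂` sum up to this flow.

**Topology.** The edges are arbitrary continuous arcs, so some duality in the style of Alexander and
Jordan is needed. All of it comes from continuous logarithms: continuous nonvanishing functions on
the plane have them (`exists_log_of_ne_zero`), and a product of powers of functions `x - q` has one
on the drawing if the corresponding combination of winding numbers vanishes on all flows
(`exists_log_on_drawing`). Three facts follow.

* The windings around different bounded faces are linearly independent functionals on the flows
  (`eq_zero_of_sum_winding_eq_zero`). Hence there are finitely many faces, and each face `f` has a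
  boundary flow `faceFlow f` that winds once around `f` and not around the other faces.
* An edge that lies on a cycle has exactly two sides, with points `left e` and `right e` next to it,
  and the weight of a flow on `e` is the difference of its windings around them. There are at most
  two sides by independence (`winding_eq_or_of_sub_eq`). There are two, with a difference of exactly
  `1`, since otherwise `(b - p) / (a - p)`, where `a` and `b` are the ends of the edge, would have a
  continuous root of some order `d ≥ 2` as a function of `p` (`not_forall_logChange_sub_eq`).
* The frontier of a face is connected, and it is the union of the edges with the face on one side
  (`isPreconnected_frontier_component`, `frontier_eq`).

**Combinatorics.** A down-flip at `f` adds `faceFlow f` to the dimer, so it lowers the height at `f`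
by `1` and does not change the other heights. A dimer has a down-flip at `f` as soon as it contains
all edges with `f` on their right and none of those with `f` on their left: these edges then form
cycles, and the connectedness of the frontier leaves only one (`exists_downFlip`). If `M` is higher
than `Z` at some face, then such a face can be found by minimizing the sum of the heights of all
dimers relative to `M`; here it is used that every edge is in some dimers but not in all of them
(`exists_downFlip_of_relHeight_pos`). So a dimer without down-flips is nowhere higher than another
one, and every other dimer comes down to it. As the rank drops by `1` with each down-flip, down-flips
are covering relations, and the height counts the flips at each face along any saturated chain. The
graph with a single dimer is treated separately, because its edges need not lie on cycles.
-/

namespace BipartitePlaneGraph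

open Set Filter Topology Complex

/-! ### Logarithms along curves and the topology of the plane -/

/-- Two continuous logarithms of the same function on a connected set differ by a constant. -/
theorem sub_eq_sub_of_exp_eq {X : Type*} [TopologicalSpace X] {s : Set X} (hs : IsPreconnected s)
    {f g : X → ℂ} (hf : ContinuousOn f s) (hg : ContinuousOn g s)
    (h : ∀ x ∈ s, exp (f x) = exp (g x)) {x y : X} (hx : x ∈ s) (hy : y ∈ s) :
    f x - g x = f y - g y := by
  have h1 : exp (f x - g x) = 1 := by rw [exp_sub, h x hx, div_self (exp_ne_zero _)]
  have key := Complex.isCoveringMap_exp.eqOn_of_comp_eqOn hs (g₁ := f)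
    (g₂ := fun y => g y + (f x - g x)) hf (hg.add continuousOn_const)
    (fun y hy => by
      apply Subtype.ext
      simp only [Function.comp_apply]
      rw [exp_add, h1, mul_one, h y hy]) hx (by ring)
  have := key hy
  simp only at this
  rw [this]; ring

/-- A continuous nowhere vanishing function on the plane has a continuous logarithm. -/
theorem exists_log_of_ne_zero {F : ℂ → ℂ} (hF : Continuous F) (h0 : ∀ x, F x ≠ 0) :
    ∃ L : C(ℂ, ℂ), ∀ x, exp (L x) = F x := by
  obtain ⟨L, ⟨-, hL⟩, -⟩ := Complex.isCoveringMapOn_exp.existsUnique_continuousMap_lifts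
    (⟨F, hF⟩ : C(ℂ, ℂ)) (a₀ := 0) (e₀ := Complex.log (F 0)) (exp_log (h0 0)) (fun a => h0 a)
  exact ⟨L, fun x => congrFun hL x⟩

/-- The complex change of `log (γ t - p)` along the curve `γ`; its imaginary part is the change of
the argument. -/
noncomputable def logChange (γ : unitInterval → ℂ) (p : ℂ) : ℂ :=
  open Classical in
  if h : ∃ L : C(unitInterval, ℂ), ∀ t, Complex.exp (L t) = γ t - p then
    h.choose 1 - h.choose 0
  else 0

theorem logChange_im (γ : unitInterval → ℂ) (p : ℂ) : (logChange γ p).im = argChange γ p := by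
  unfold logChange argChange
  split_ifs <;> simp

theorem logChange_eq (γ : unitInterval → ℂ) (p : ℂ) (L : C(unitInterval, ℂ))
    (hL : ∀ t, Complex.exp (L t) = γ t - p) : logChange γ p = L 1 - L 0 := by
  have h : ∃ L : C(unitInterval, ℂ), ∀ t, Complex.exp (L t) = γ t - p := ⟨L, hL⟩
  rw [logChange, dif_pos h]
  have hK := h.choose_spec
  have := sub_eq_sub_of_exp_eq (isPreconnected_univ (α := unitInterval))
    h.choose.continuous.continuousOn L.continuous.continuousOn
    (fun t _ => by rw [hK, hL]) (mem_univ 1) (mem_univ 0)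
  linear_combination this

theorem exp_logChange {γ : unitInterval → ℂ} (hγ : Continuous γ) {p : ℂ} (hp : p ∉ range γ) :
    exp (logChange γ p) = (γ 1 - p) / (γ 0 - p) := by
  obtain ⟨L, hL⟩ := exists_branch γ hγ p fun t h => hp ⟨t, h⟩
  rw [logChange_eq γ p L hL, exp_sub, hL, hL]

/-- Near a point `p₀` off the curve, the change of `log (γ - p)` differs from that at `p₀` by a
principal logarithm that depends only on the two ends of the curve. -/
theorem eventually_logChange_eq {γ : unitInterval → ℂ} (hγ : Continuous γ) {p₀ : ℂ}
    (hp : p₀ ∉ range γ) : ∀ᶠ p in 𝓝 p₀, logChange γ p = logChange γ p₀ +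
      (log (1 + (p₀ - p) / (γ 1 - p₀)) - log (1 + (p₀ - p) / (γ 0 - p₀))) := by
  have hcl : IsClosed (range γ) := (isCompact_range hγ).isClosed
  obtain ⟨r, hr, hball⟩ := Metric.isOpen_iff.1 hcl.isOpen_compl p₀ hp
  obtain ⟨L, hL⟩ := exists_branch γ hγ p₀ fun t h => hp ⟨t, h⟩
  filter_upwards [Metric.ball_mem_nhds p₀ hr] with p hpr
  have hne : ∀ t, γ t - p₀ ≠ 0 := fun t h => hp ⟨t, sub_eq_zero.1 h⟩
  have hsmall : ∀ t, ‖(p₀ - p) / (γ t - p₀)‖ < 1 := fun t => by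
    rw [norm_div, div_lt_one (norm_pos_iff.2 (hne t))]
    have h1 : ‖p₀ - p‖ < r := by rw [← dist_eq_norm, dist_comm]; exact hpr
    refine h1.trans_le (not_lt.1 fun h => ?_)
    have : γ t ∈ Metric.ball p₀ r := by rw [Metric.mem_ball, dist_eq_norm]; exact h
    exact hball this ⟨t, rfl⟩
  have hc : Continuous fun t => log (1 + (p₀ - p) / (γ t - p₀)) := by
    refine Continuous.clog ?_ fun t => mem_slitPlane_of_norm_lt_one (hsmall t)
    exact continuous_const.add (continuous_const.div (hγ.sub continuous_const) hne)
  have key := logChange_eq γ p ⟨fun t => L t + log (1 + (p₀ - p) / (γ t - p₀)),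
    L.continuous.add hc⟩ (fun t => by
      have := slitPlane_ne_zero (mem_slitPlane_of_norm_lt_one (hsmall t))
      have h2 := hne t
      simp only [ContinuousMap.coe_mk]
      rw [exp_add, hL, exp_log this]
      field_simp
      ring)
  rw [key, logChange_eq γ p₀ L hL]
  simp only [ContinuousMap.coe_mk]
  ring

theorem continuousOn_logChange {γ : unitInterval → ℂ} (hγ : Continuous γ) :
    ContinuousOn (logChange γ) (range γ)ᶜ := by
  intro p₀ hp
  refine ContinuousAt.continuousWithinAt ?_
  refine ContinuousAt.congr_of_eventuallyEq ?_ (eventually_logChange_eq hγ hp)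
  have h (t) : ContinuousAt (fun p => log (1 + (p₀ - p) / (γ t - p₀))) p₀ := by
    refine ContinuousAt.clog (by fun_prop) (by simp)
  exact continuousAt_const.add ((h 1).sub (h 0))

/-- The circle of radius `r` around `a`, traversed once counterclockwise. -/
noncomputable def circleCurve (a : ℂ) (r : ℝ) (t : unitInterval) : ℂ :=
  a + r * exp (2 * Real.pi * I * (t : ℝ))

theorem continuous_circleCurve (a : ℂ) (r : ℝ) : Continuous (circleCurve a r) := by
  unfold circleCurve; fun_prop

theorem norm_circleCurve_sub (a : ℂ) {r : ℝ} (hr : 0 < r) (t : unitInterval) :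
    ‖circleCurve a r t - a‖ = r := by
  have : (2 * Real.pi * I * (t : ℝ) : ℂ) = ((2 * Real.pi * (t : ℝ) : ℝ) : ℂ) * I := by
    push_cast; ring
  simp only [circleCurve, add_sub_cancel_left, norm_mul, norm_real, this, norm_exp_ofReal_mul_I,
    mul_one, Real.norm_eq_abs, abs_of_pos hr]

theorem circleCurve_zero_eq_one (a : ℂ) (r : ℝ) : circleCurve a r 0 = circleCurve a r 1 := by
  simp [circleCurve, exp_two_pi_mul_I]

theorem logChange_circleCurve_self (a : ℂ) {r : ℝ} (hr : 0 < r) :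
    logChange (circleCurve a r) a = 2 * Real.pi * I := by
  have h := logChange_eq (circleCurve a r) a
    ⟨fun t => log r + 2 * Real.pi * I * (t : ℝ), by fun_prop⟩ (fun t => by
      have : (r : ℂ) ≠ 0 := by exact_mod_cast hr.ne'
      simp [circleCurve, exp_add, exp_log this])
  rw [h]; simp

theorem logChange_circleCurve_of_lt {a b : ℂ} {r : ℝ} (hr : 0 < r) (hb : r < ‖a - b‖) :
    logChange (circleCurve a r) b = 0 := by
  have hab : a - b ≠ 0 := norm_pos_iff.1 (hr.trans hb)
  have hsmall : ∀ t, ‖(circleCurve a r t - a) / (a - b)‖ < 1 := fun t => by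
    rw [norm_div, div_lt_one (hr.trans hb), norm_circleCurve_sub a hr]; exact hb
  have hc : Continuous fun t => log (1 + (circleCurve a r t - a) / (a - b)) := by
    refine Continuous.clog ?_ fun t => mem_slitPlane_of_norm_lt_one (hsmall t)
    exact continuous_const.add
      (((continuous_circleCurve a r).sub continuous_const).div_const _)
  have h := logChange_eq (circleCurve a r) b
    ⟨fun t => log (a - b) + log (1 + (circleCurve a r t - a) / (a - b)),
      continuous_const.add hc⟩ (fun t => by
      have := slitPlane_ne_zero (mem_slitPlane_of_norm_lt_one (hsmall t))
      simp only [ContinuousMap.coe_mk]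
      rw [exp_add, exp_log hab, exp_log this]
      field_simp
      ring)
  rw [h]; simp [circleCurve_zero_eq_one]

/-- A power of `x - p` cannot be extended from the outside of a disc to the whole plane without
zeros: the no-retraction theorem. -/
theorem eq_zero_of_eq_zpow_outside {F : ℂ → ℂ} (hF : Continuous F) (h0 : ∀ x, F x ≠ 0) {p : ℂ}
    {n : ℤ} {R : ℝ} (h : ∀ x, R ≤ ‖x - p‖ → F x = (x - p) ^ n) : n = 0 := by
  obtain ⟨L, hL⟩ := exists_log_of_ne_zero hF h0
  set r := max R 1
  have hr : 0 < r := lt_of_lt_of_le one_pos (le_max_right _ _)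
  have hc := continuous_circleCurve p r
  obtain ⟨K, hK⟩ := exists_branch (circleCurve p r) hc p fun t ht => by
    have := norm_circleCurve_sub p hr t
    rw [ht] at this; simp at this; exact hr.ne this
  have h1 := sub_eq_sub_of_exp_eq (isPreconnected_univ (α := unitInterval))
    (f := fun t => L (circleCurve p r t)) (g := fun t => n * K t)
    (L.continuous.comp hc).continuousOn
    (continuous_const.mul K.continuous).continuousOn (fun t _ => by
      rw [hL, h _ (by rw [norm_circleCurve_sub p hr]; exact le_max_left _ _), exp_int_mul, hK])
      (mem_univ 0) (mem_univ 1)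
  have h2 := logChange_eq _ _ K hK
  rw [logChange_circleCurve_self p hr] at h2
  simp only [circleCurve_zero_eq_one] at h1
  have h3 : (n : ℂ) * (2 * Real.pi * I) = 0 := by rw [h2]; linear_combination h1
  have h4 : (2 * Real.pi * I : ℂ) ≠ 0 := two_pi_I_ne_zero
  exact_mod_cast (mul_eq_zero.1 h3).resolve_right h4

/-- The frontier of a component of the complement of a connected closed set is connected. -/
theorem isPreconnected_frontier_component {K U : Set ℂ} (hKc : IsPreconnected K)
    (hU : IsOpen U) (hUc : IsPreconnected U) (hUK : Disjoint U K) (hfr : frontier U ⊆ K) :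
    IsPreconnected (frontier U) := by
  classical
  rw [isPreconnected_closed_iff]
  intro A B hA hB hAB hne1 hne2
  by_contra hemp
  rw [not_nonempty_iff_eq_empty] at hemp
  have hfc : IsClosed (frontier U) := isClosed_frontier
  have hA' := hfc.inter hA
  have hB' := hfc.inter hB
  have hd : Disjoint (frontier U ∩ A) (frontier U ∩ B) := by
    rw [disjoint_iff_inter_eq_empty, ← inter_inter_distrib_left]; exact hemp
  -- a function that is `0` on one part of the frontier and `1` on the other
  obtain ⟨θ, hθ0, hθ1, -⟩ := exists_continuous_zero_one_of_isClosed hA' hB' hd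
  have hexp : ∀ x ∈ frontier U, exp (2 * Real.pi * I * (θ x : ℝ)) = 1 := by
    intro x hx
    rcases hAB hx with h | h
    · rw [hθ0 ⟨hx, h⟩]; simp
    · rw [hθ1 ⟨hx, h⟩]; simp [exp_two_pi_mul_I]
  have hF : Continuous fun x => if x ∈ U then exp (2 * Real.pi * I * (θ x : ℝ)) else (1 : ℂ) :=
    continuous_if hexp (by fun_prop) continuousOn_const
  obtain ⟨L, hL⟩ := exists_log_of_ne_zero hF (fun x => by split_ifs <;> simp [exp_ne_zero])
  obtain ⟨a, haf, haA⟩ := hne1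
  obtain ⟨b, hbf, hbB⟩ := hne2
  have hcU : ∀ x ∈ closure U, exp (L x) = exp (2 * Real.pi * I * (θ x : ℝ)) := by
    intro x hx
    rw [hL]
    by_cases hxU : x ∈ U
    · simp [hxU]
    · simp only [hxU, if_false]
      rw [hexp x]
      rw [frontier, hU.interior_eq]; exact ⟨hx, hxU⟩
  have e1 := sub_eq_sub_of_exp_eq hUc.closure L.continuous.continuousOn
    (by fun_prop) hcU (frontier_subset_closure haf) (frontier_subset_closure hbf)
  have e2 := sub_eq_sub_of_exp_eq hKc L.continuous.continuousOn (g := fun _ => 0)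
    continuousOn_const (fun x hx => by
      rw [hL, if_neg (fun h => disjoint_left.1 hUK h hx), exp_zero]) (hfr haf) (hfr hbf)
  rw [hθ0 ⟨haf, haA⟩, hθ1 ⟨hbf, hbB⟩] at e1
  have h4 : (2 * Real.pi * I : ℂ) ≠ 0 := two_pi_I_ne_zero
  simp only [Pi.zero_apply, Pi.one_apply, ofReal_zero, ofReal_one] at e1
  apply h4
  linear_combination e1 - e2

/-- The jump of the winding number across an arc. Let `σ` be a curve from `a` to `b ≠ a` and `B` a
closed set that meets it only in its ends, let `ψ` be a continuous logarithm of
`(b - p) / (a - p)` off `B`, and let `F` be an open set off `B` that contains the interior of the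
curve. Then the integer `(logChange σ p - ψ p) / (2 π i)` is not constant modulo `d ≥ 2` on the part
of `F` off the curve, since otherwise `(b - p) / (a - p)` would have a continuous `d`-th root. -/
theorem not_forall_logChange_sub_eq {σ : unitInterval → ℂ} (hσ : Continuous σ) {B F : Set ℂ}
    (hB : IsClosed B) (hab : σ 0 ≠ σ 1)
    (hF : IsOpen F) (hFB : Disjoint F B) (hAF : ∀ t, σ t ≠ σ 0 → σ t ≠ σ 1 → σ t ∈ F)
    {ψ : ℂ → ℂ} (hψ : ContinuousOn ψ Bᶜ)
    (hψe : ∀ p, p ∉ B → exp (ψ p) = (σ 1 - p) / (σ 0 - p)) {d : ℕ} (hd : 2 ≤ d) (n : ℤ) :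
    ¬ ∀ p ∈ F, p ∉ range σ →
      ∃ k : ℤ, logChange σ p - ψ p = 2 * Real.pi * I * (n + d * k) := by
  classical
  intro h
  have hd0 : (d : ℂ) ≠ 0 := by exact_mod_cast (by omega : d ≠ 0)
  set a := σ 0
  set b := σ 1
  have hcl : IsClosed (range σ) := (isCompact_range hσ).isClosed
  -- the continuous `d`-th root of `(b - p) / (a - p)`
  set g : ℂ → ℂ := fun p => if p ∈ range σ then exp ((ψ p + 2 * Real.pi * I * n) / d)
    else exp (logChange σ p / d) with hg
  have hgF : ∀ p ∈ F, g p = exp ((ψ p + 2 * Real.pi * I * n) / d) := by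
    intro p hp
    by_cases hpσ : p ∈ range σ
    · simp only [hg]; rw [if_pos hpσ]
    · obtain ⟨k, hk⟩ := h p hp hpσ
      simp only [hg, hpσ, if_false]
      have : logChange σ p / d = (ψ p + 2 * Real.pi * I * n) / d + k * (2 * Real.pi * I) := by
        field_simp
        linear_combination hk
      rw [this, exp_add, exp_int_mul_two_pi_mul_I, mul_one]
  have hcov : ∀ p, p ≠ a → p ≠ b → p ∈ range σ → p ∈ F := by
    rintro p h1 h2 ⟨t, rfl⟩
    exact hAF t h1 h2
  have hgcont : ∀ p, p ≠ a → p ≠ b → ContinuousAt g p := by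
    intro p h1 h2
    by_cases hpσ : p ∈ range σ
    · have hpF := hcov p h1 h2 hpσ
      have : ContinuousAt (fun p => exp ((ψ p + 2 * Real.pi * I * n) / d)) p := by
        have hψp : ContinuousAt ψ p := hψ.continuousAt
          (hB.isOpen_compl.mem_nhds fun hb => disjoint_left.1 hFB hpF hb)
        exact ((hψp.add continuousAt_const).div_const _).cexp
      refine this.congr_of_eventuallyEq ?_
      filter_upwards [hF.mem_nhds hpF] with q hq using hgF q hq
    · have hc : ContinuousAt (fun p => exp (logChange σ p / d)) p :=
        (((continuousOn_logChange hσ).continuousAt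
          (hcl.isOpen_compl.mem_nhds hpσ)).div_const _).cexp
      refine hc.congr_of_eventuallyEq ?_
      filter_upwards [hcl.isOpen_compl.mem_nhds hpσ] with q hq
      simp only [hg]; rw [if_neg hq]
  have hgd : ∀ p, p ≠ a → p ≠ b → g p ^ d = (b - p) / (a - p) := by
    intro p h1 h2
    by_cases hpσ : p ∈ range σ
    · have hpF := hcov p h1 h2 hpσ
      rw [hgF p hpF, ← exp_nat_mul, mul_div_cancel₀ _ hd0, exp_add,
        hψe p (fun hb => disjoint_left.1 hFB hpF hb), mul_comm (2 * Real.pi * I : ℂ),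
        exp_int_mul_two_pi_mul_I, mul_one]
    · simp only [hg]
      rw [if_neg hpσ, ← exp_nat_mul, mul_div_cancel₀ _ hd0, exp_logChange hσ hpσ]
  -- contradiction along a small circle around `a`
  set r := ‖a - b‖ / 2
  have hpos : 0 < ‖a - b‖ := norm_pos_iff.2 (sub_ne_zero.2 hab)
  have hr : 0 < r := by positivity
  have hrb : r < ‖a - b‖ := by simp only [r]; linarith
  set γ := circleCurve a r
  have hγ : Continuous γ := continuous_circleCurve a r
  have hγa : ∀ t, γ t ≠ a := fun t ht => by
    have := norm_circleCurve_sub a hr t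
    rw [show circleCurve a r t = a from ht] at this; simp at this; exact hr.ne this
  have hγb : ∀ t, γ t ≠ b := fun t ht => by
    have := norm_circleCurve_sub a hr t
    rw [show circleCurve a r t = b from ht, norm_sub_rev] at this; exact hrb.ne' this
  obtain ⟨La, hLa⟩ := exists_branch γ hγ a hγa
  obtain ⟨Lb, hLb⟩ := exists_branch γ hγ b hγb
  have hgγ : Continuous fun t => g (γ t) := continuous_iff_continuousAt.2 fun t =>
    ContinuousAt.comp (f := γ) (hgcont (γ t) (hγa t) (hγb t)) hγ.continuousAt
  have hgne : ∀ p, g p ≠ 0 := fun p => by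
    simp only [hg]; split_ifs <;> exact exp_ne_zero _
  obtain ⟨L, hL⟩ := exists_branch (fun t => g (γ t)) hgγ 0 (fun t => hgne _)
  have key := sub_eq_sub_of_exp_eq (isPreconnected_univ (α := unitInterval))
    (f := fun t => d * L t) (g := fun t => Lb t - La t)
    (continuous_const.mul L.continuous).continuousOn
    (Lb.continuous.sub La.continuous).continuousOn (fun t _ => by
      rw [exp_nat_mul, hL, sub_zero, hgd _ (hγa t) (hγb t), exp_sub, hLa, hLb,
        ← neg_sub b, ← neg_sub a, neg_div_neg_eq])
      (mem_univ 0) (mem_univ 1)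
  have ha := logChange_eq _ _ La hLa
  rw [logChange_circleCurve_self a hr] at ha
  have hb := logChange_eq _ _ Lb hLb
  rw [logChange_circleCurve_of_lt hr hrb] at hb
  have h10 : exp (L 1) = exp (L 0) := by
    rw [hL, hL]; simp only [γ, circleCurve_zero_eq_one]
  obtain ⟨k, hk⟩ := Complex.exp_eq_exp_iff_exists_int.1 h10
  have h5 : (2 * Real.pi * I) * ((d : ℂ) * k + 1) = 0 := by
    rw [hk] at key
    linear_combination (-1 : ℂ) * key - hb + ha
  have h6 := (mul_eq_zero.1 h5).resolve_left two_pi_I_ne_zero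
  have h7 : (d : ℤ) * k + 1 = 0 := by exact_mod_cast h6
  have h8 : (d : ℤ) ∣ 1 := ⟨-k, by linarith⟩
  have := Int.le_of_dvd one_pos h8
  omega

/-! ### Flows and their winding numbers -/

variable {V E : Type*} {G : BipartitePlaneGraph V E}

variable (G)

open Classical in
/-- The map that sends a weight on the edges to its sums at the black and at the white end of edges
at each vertex. -/
noncomputable def vertexSums [Fintype E] : (E → ℚ) →ₗ[ℚ] (V → ℚ) × (V → ℚ) where
  toFun z := (fun v => ∑ e, if G.black e = v then z e else 0,
    fun v => ∑ e, if G.white e = v then z e else 0)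
  map_add' z z' := by
    ext v <;> simp only [Prod.fst_add, Prod.snd_add, Pi.add_apply, ← Finset.sum_add_distrib] <;>
    exact Finset.sum_congr rfl fun e _ => by split_ifs <;> simp
  map_smul' c z := by
    ext v <;> simp only [Prod.smul_fst, Prod.smul_snd, Pi.smul_apply, Finset.smul_sum] <;>
    exact Finset.sum_congr rfl fun e _ => by split_ifs <;> simp

/-- The rational cycle space: the weights on the edges, oriented from black to white, that are
divergence-free. As all edges at a black vertex leave it and all edges at a white vertex enter it,
this says that the weights of the edges at each vertex sum to zero. -/
noncomputable def flows [Fintype E] : Submodule ℚ (E → ℚ) := LinearMap.ker G.vertexSums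

variable {G}

theorem mem_flows [Fintype E] [DecidableEq V] {z : E → ℚ} : z ∈ G.flows ↔
    (∀ v, ∑ e, (if G.black e = v then z e else 0) = 0) ∧
    (∀ v, ∑ e, (if G.white e = v then z e else 0) = 0) := by
  rw [flows, LinearMap.mem_ker, vertexSums, LinearMap.coe_mk, AddHom.coe_mk, Prod.mk_eq_zero,
    funext_iff, funext_iff]
  simp only [Pi.zero_apply]
  exact ⟨fun h => ⟨fun v => by convert h.1 v, fun v => by convert h.2 v⟩,
    fun h => ⟨fun v => by convert h.1 v, fun v => by convert h.2 v⟩⟩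

theorem sum_black_of_mem_flows [Fintype E] {z : E → ℚ} (hz : z ∈ G.flows) (g : V → ℂ) :
    ∑ e, (z e : ℂ) * g (G.black e) = 0 := by
  classical
  have h := (mem_flows.1 hz).1
  rw [← Finset.sum_fiberwise_of_maps_to (t := Finset.univ.image G.black) (g := G.black)
    (fun e _ => Finset.mem_image_of_mem _ (Finset.mem_univ e))]
  refine Finset.sum_eq_zero fun v _ => ?_
  rw [Finset.sum_congr rfl (g := fun e => (z e : ℂ) * g v)
    (fun e he => by rw [(Finset.mem_filter.1 he).2]), ← Finset.sum_mul, Finset.sum_filter]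
  have := congrArg (fun q : ℚ => (q : ℂ)) (h v)
  push_cast at this
  simp only [apply_ite (Rat.cast : ℚ → ℂ), Rat.cast_zero] at this
  rw [this, zero_mul]

theorem sum_white_of_mem_flows [Fintype E] {z : E → ℚ} (hz : z ∈ G.flows) (g : V → ℂ) :
    ∑ e, (z e : ℂ) * g (G.white e) = 0 := by
  classical
  have h := (mem_flows.1 hz).2
  rw [← Finset.sum_fiberwise_of_maps_to (t := Finset.univ.image G.white) (g := G.white)
    (fun e _ => Finset.mem_image_of_mem _ (Finset.mem_univ e))]
  refine Finset.sum_eq_zero fun v _ => ?_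
  rw [Finset.sum_congr rfl (g := fun e => (z e : ℂ) * g v)
    (fun e he => by rw [(Finset.mem_filter.1 he).2]), ← Finset.sum_mul, Finset.sum_filter]
  have := congrArg (fun q : ℚ => (q : ℂ)) (h v)
  push_cast at this
  simp only [apply_ite (Rat.cast : ℚ → ℂ), Rat.cast_zero] at this
  rw [this, zero_mul]

theorem sum_sub_of_mem_flows [Fintype E] {z : E → ℚ} (hz : z ∈ G.flows) (g : V → ℂ) :
    ∑ e, (z e : ℂ) * (g (G.white e) - g (G.black e)) = 0 := by
  simp only [mul_sub, Finset.sum_sub_distrib, sum_black_of_mem_flows hz, sum_white_of_mem_flows hz,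
    sub_zero]

/-- An integral cocycle that vanishes on all flows is a coboundary. -/
theorem exists_potential [Fintype E] [Fintype V] (hG : G.toSimpleGraph.Connected) (κ : E → ℤ)
    (h : ∀ z ∈ G.flows, ∑ e, z e * (κ e : ℚ) = 0) :
    ∃ m : V → ℤ, ∀ e, κ e = m (G.white e) - m (G.black e) := by
  classical
  let φ : Module.Dual ℚ (E → ℚ) := ∑ e, (κ e : ℚ) • LinearMap.proj e
  have hφ (z : E → ℚ) : φ z = ∑ e, z e * (κ e : ℚ) := by
    simp [φ, LinearMap.sum_apply, mul_comm]
  have hmem : φ ∈ LinearMap.range G.vertexSums.dualMap := by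
    rw [LinearMap.range_dualMap_eq_dualAnnihilator_ker, Submodule.mem_dualAnnihilator]
    intro z hz
    rw [hφ]; exact h z hz
  obtain ⟨ψ, hψ⟩ := hmem
  let μ : V → ℚ := fun v => if G.IsBlack v then -ψ (Pi.single v 1, 0) else ψ (0, Pi.single v 1)
  have hμ : ∀ e, (κ e : ℚ) = μ (G.white e) - μ (G.black e) := by
    intro e
    have h1 : φ (Pi.single e 1) = κ e := by
      rw [hφ, Finset.sum_eq_single e]
      · simp
      · intro b _ hb; simp [hb]
      · simp
    have h2 : G.vertexSums (Pi.single e 1) =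
        (Pi.single (G.black e) 1, 0) + (0, Pi.single (G.white e) 1) := by
      rw [Prod.mk_add_mk, add_zero, zero_add, vertexSums, LinearMap.coe_mk, AddHom.coe_mk]
      refine Prod.ext (funext fun v => ?_) (funext fun v => ?_)
      all_goals
        simp only
        rw [Finset.sum_eq_single e]
        · simp [Pi.single_apply, eq_comm]
        · intro b _ hb; simp [hb]
        · simp
    rw [← h1, ← hψ, LinearMap.dualMap_apply, h2, map_add]
    simp only [μ, if_pos (G.isBlack_black e), if_neg (G.not_isBlack_white e)]
    ring
  obtain ⟨r⟩ := hG.nonempty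
  have hint : ∀ v, ∃ n : ℤ, μ v - μ r = n := by
    intro v
    have hr := (SimpleGraph.reachable_iff_reflTransGen r v).1 (hG.preconnected r v)
    induction hr with
    | refl => exact ⟨0, by simp⟩
    | tail _ hadj ih =>
      obtain ⟨n, hn⟩ := ih
      obtain ⟨e, ⟨rfl, rfl⟩ | ⟨rfl, rfl⟩⟩ := hadj
      · exact ⟨n + κ e, by push_cast; rw [hμ, ← hn]; ring⟩
      · exact ⟨n - κ e, by push_cast; rw [hμ, ← hn]; ring⟩
  choose m hm using hint
  refine ⟨m, fun e => ?_⟩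
  have : (κ e : ℚ) = (m (G.white e) : ℚ) - m (G.black e) := by rw [hμ, ← hm, ← hm]; ring
  exact_mod_cast this

variable (G)

/-- The number of full turns by which the change of `log (· - p)` along the edge `e` exceeds the
difference of the principal values at its ends. Off the edge the rounded quotient is an integer, see
`logChange_arc`. -/
noncomputable def turns (e : E) (p : ℂ) : ℤ :=
  round ((logChange (G.arc e) p -
    (log (G.pos (G.white e) - p) - log (G.pos (G.black e) - p))).im / (2 * Real.pi))

variable {G}

theorem pos_mem_range_black (e : E) : G.pos (G.black e) ∈ range (G.arc e) := ⟨0, (G.arc e).source⟩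

theorem pos_mem_range_white (e : E) : G.pos (G.white e) ∈ range (G.arc e) := ⟨1, (G.arc e).target⟩

theorem logChange_arc {e : E} {p : ℂ} (hp : p ∉ range (G.arc e)) :
    logChange (G.arc e) p = log (G.pos (G.white e) - p) - log (G.pos (G.black e) - p) +
      2 * Real.pi * I * G.turns e p := by
  have hb : G.pos (G.black e) - p ≠ 0 := fun h => hp (sub_eq_zero.1 h ▸ pos_mem_range_black e)
  have hw : G.pos (G.white e) - p ≠ 0 := fun h => hp (sub_eq_zero.1 h ▸ pos_mem_range_white e)
  have h1 : exp (logChange (G.arc e) p) =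
      exp (log (G.pos (G.white e) - p) - log (G.pos (G.black e) - p)) := by
    rw [exp_logChange (G.arc e).continuous hp, exp_sub, exp_log hb, exp_log hw]
    simp
  obtain ⟨k, hk⟩ := exp_eq_exp_iff_exists_int.1 h1
  have h2 : G.turns e p = k := by
    rw [turns, hk]
    have : (log (G.pos (G.white e) - p) - log (G.pos (G.black e) - p) + k * (2 * Real.pi * I) -
      (log (G.pos (G.white e) - p) - log (G.pos (G.black e) - p))).im / (2 * Real.pi) = k := by
      rw [add_sub_cancel_left]
      have : ((k : ℂ) * (2 * Real.pi * I)) = ((k * (2 * Real.pi) : ℝ) : ℂ) * I := by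
        push_cast; ring
      rw [this, im_ofReal_mul, I_im, mul_one]
      field_simp
    rw [this, round_intCast]
  rw [h2, hk]; ring

variable (G)

/-- The winding number of a flow around a point. -/
noncomputable def winding [Fintype E] (z : E → ℚ) (p : ℂ) : ℚ := ∑ e, z e * G.turns e p

variable {G}

theorem range_arc_subset_drawing (e : E) : range (G.arc e) ⊆ G.drawing :=
  subset_union_of_subset_right (subset_iUnion (fun e => range (G.arc e)) e) _

theorem pos_mem_drawing (v : V) : G.pos v ∈ G.drawing := Or.inl ⟨v, rfl⟩

theorem isCompact_drawing [Finite E] [Finite V] : IsCompact G.drawing :=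
  (finite_range _).isCompact.union (isCompact_iUnion fun e => isCompact_range (G.arc e).continuous)

theorem winding_add [Fintype E] (z z' : E → ℚ) (p : ℂ) :
    G.winding (z + z') p = G.winding z p + G.winding z' p := by
  simp [winding, add_mul, Finset.sum_add_distrib]

theorem winding_smul [Fintype E] (c : ℚ) (z : E → ℚ) (p : ℂ) :
    G.winding (c • z) p = c * G.winding z p := by
  simp [winding, Finset.mul_sum, mul_assoc]

theorem winding_sub [Fintype E] (z z' : E → ℚ) (p : ℂ) :
    G.winding (z - z') p = G.winding z p - G.winding z' p := by
  simp [winding, sub_mul, Finset.sum_sub_distrib]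

theorem winding_neg [Fintype E] (z : E → ℚ) (p : ℂ) :
    G.winding (-z) p = - G.winding z p := by
  simp [winding]

theorem winding_eq_sum_logChange [Fintype E] {z : E → ℚ} (hz : z ∈ G.flows) {p : ℂ}
    (hp : ∀ e, z e ≠ 0 → p ∉ range (G.arc e)) :
    2 * Real.pi * I * (G.winding z p : ℂ) = ∑ e, (z e : ℂ) * logChange (G.arc e) p := by
  have : ∀ e, (z e : ℂ) * logChange (G.arc e) p = (z e : ℂ) *
      (log (G.pos (G.white e) - p) - log (G.pos (G.black e) - p)) +
      2 * Real.pi * I * (z e * G.turns e p) := fun e => by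
    by_cases hze : z e = 0
    · simp [hze]
    · rw [logChange_arc (hp e hze)]; ring
  rw [Finset.sum_congr rfl fun e _ => this e, Finset.sum_add_distrib,
    sum_sub_of_mem_flows hz fun v => log (G.pos v - p), zero_add, winding, ← Finset.mul_sum]
  push_cast
  rfl

/-- The winding number of a flow is constant on connected sets that its edges do not meet. -/
theorem winding_eq_of_isPreconnected [Fintype E] {z : E → ℚ} (hz : z ∈ G.flows) {S : Set ℂ}
    (hS : IsPreconnected S) (hd : ∀ e, z e ≠ 0 → Disjoint S (range (G.arc e))) {p q : ℂ}
    (hp : p ∈ S) (hq : q ∈ S) : G.winding z p = G.winding z q := by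
  refine hS.induction₂ (fun p q => G.winding z p = G.winding z q) ?_
    (fun _ _ _ _ _ _ h h' => h.trans h') (fun _ _ _ _ h => h.symm) hp hq
  intro x hx
  have hev : ∀ᶠ y in 𝓝 x, ∀ e, z e ≠ 0 → logChange (G.arc e) y = logChange (G.arc e) x +
      (log (1 + (x - y) / (G.arc e 1 - x)) - log (1 + (x - y) / (G.arc e 0 - x))) := by
    rw [eventually_all]
    intro e
    by_cases hze : z e = 0
    · simp [hze]
    · filter_upwards [eventually_logChange_eq (G.arc e).continuous
        (disjoint_left.1 (hd e hze) hx)] with y hy _ using hy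
  filter_upwards [nhdsWithin_le_nhds hev, self_mem_nhdsWithin] with y hy hyS
  have h1 := winding_eq_sum_logChange hz (p := x) fun e he => disjoint_left.1 (hd e he) hx
  have h2 := winding_eq_sum_logChange hz (p := y) fun e he => disjoint_left.1 (hd e he) hyS
  have h3 : ∑ e, (z e : ℂ) * logChange (G.arc e) y = ∑ e, (z e : ℂ) * logChange (G.arc e) x := by
    have : ∀ e, (z e : ℂ) * logChange (G.arc e) y = (z e : ℂ) * logChange (G.arc e) x +
        (z e : ℂ) * (log (1 + (x - y) / (G.pos (G.white e) - x)) -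
          log (1 + (x - y) / (G.pos (G.black e) - x))) := fun e => by
      by_cases hze : z e = 0
      · simp [hze]
      · rw [hy e hze, Path.source, Path.target]; ring
    rw [Finset.sum_congr rfl fun e _ => this e, Finset.sum_add_distrib,
      sum_sub_of_mem_flows hz fun v => log (1 + (x - y) / (G.pos v - x)), add_zero]
  rw [h3, ← h1] at h2
  have := mul_left_cancel₀ two_pi_I_ne_zero h2
  exact_mod_cast this.symm

theorem winding_eq_of_mem_component [Fintype E] {z : E → ℚ} (hz : z ∈ G.flows) {p q : ℂ}
    (hp : p ∉ G.drawing) (hq : q ∈ connectedComponentIn G.drawingᶜ p) :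
    G.winding z p = G.winding z q :=
  winding_eq_of_isPreconnected hz isPreconnected_connectedComponentIn
    (fun e _ => disjoint_left.2 fun x hx hx' =>
      (connectedComponentIn_subset _ _ hx : x ∉ G.drawing) (range_arc_subset_drawing e hx'))
    (mem_connectedComponentIn hp) hq

/-- Flows do not wind around the points outside of a disc that contains the drawing. -/
theorem winding_eq_zero_of_norm_lt [Fintype E] {z : E → ℚ} (hz : z ∈ G.flows) {p : ℂ}
    (h : ∀ x ∈ G.drawing, ‖x‖ < ‖p‖) : G.winding z p = 0 := by
  have hpK : p ∉ G.drawing := fun hp => lt_irrefl _ (h p hp)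
  have key : ∀ e, logChange (G.arc e) p =
      log (1 + -(G.pos (G.white e) / p)) - log (1 + -(G.pos (G.black e) / p)) := by
    intro e
    have hp0 : p ≠ 0 := norm_pos_iff.1
      ((norm_nonneg _).trans_lt (h _ (pos_mem_drawing (G.black e))))
    have hsmall : ∀ t, ‖-(G.arc e t / p)‖ < 1 := fun t => by
      rw [norm_neg, norm_div, div_lt_one (norm_pos_iff.2 hp0)]
      exact h _ (range_arc_subset_drawing e ⟨t, rfl⟩)
    have hc : Continuous fun t => log (1 + -(G.arc e t / p)) := by
      refine Continuous.clog ?_ fun t => mem_slitPlane_of_norm_lt_one (hsmall t)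
      exact continuous_const.add ((G.arc e).continuous.div_const _).neg
    rw [logChange_eq (G.arc e) p ⟨fun t => log (-p) + log (1 + -(G.arc e t / p)),
      continuous_const.add hc⟩ fun t => by
        have := slitPlane_ne_zero (mem_slitPlane_of_norm_lt_one (hsmall t))
        simp only [ContinuousMap.coe_mk]
        rw [exp_add, exp_log (neg_ne_zero.2 hp0), exp_log this]
        field_simp
        ring]
    simp
  have h1 := winding_eq_sum_logChange hz (p := p) fun e _ he => hpK (range_arc_subset_drawing e he)
  rw [Finset.sum_congr rfl fun e _ => by rw [key e],
    sum_sub_of_mem_flows hz fun v => log (1 + -(G.pos v / p))] at h1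
  exact_mod_cast (mul_eq_zero.1 h1).resolve_left two_pi_I_ne_zero

theorem winding_eq_zero_of_not_isBounded [Fintype E] [Finite V] {z : E → ℚ} (hz : z ∈ G.flows)
    {p : ℂ} (hp : p ∉ G.drawing)
    (hb : ¬ Bornology.IsBounded (connectedComponentIn G.drawingᶜ p)) : G.winding z p = 0 := by
  obtain ⟨R, hR⟩ := (isCompact_drawing (G := G)).isBounded.exists_norm_le
  have : ∃ q ∈ connectedComponentIn G.drawingᶜ p, R < ‖q‖ := by
    by_contra hcon
    push Not at hcon
    exact hb (isBounded_iff_forall_norm_le.2 ⟨R, hcon⟩)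
  obtain ⟨q, hq, hRq⟩ := this
  rw [winding_eq_of_mem_component hz hp hq]
  exact winding_eq_zero_of_norm_lt hz fun x hx => (hR x hx).trans_lt hRq

/-! ### Independence of the windings around different faces -/

/-- If a combination of windings vanishes on all flows, then the corresponding product of powers has
a continuous logarithm on the drawing (extended here to the plane as a continuous function). -/
theorem exists_log_on_drawing [Fintype V] [Fintype E] (hG : G.toSimpleGraph.Connected)
    (hV : ∀ v, ∃ e, G.black e = v ∨ G.white e = v) {ι : Type*} (s : Finset ι) (q : ι → ℂ)
    (m : ι → ℤ) (hq : ∀ i ∈ s, q i ∉ G.drawing)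
    (h : ∀ z ∈ G.flows, ∑ i ∈ s, (m i : ℚ) * G.winding z (q i) = 0) :
    ∃ L : C(ℂ, ℂ), ∀ x ∈ G.drawing, exp (L x) = ∏ i ∈ s, (x - q i) ^ m i := by
  obtain ⟨M, hM⟩ := exists_potential hG (fun e => ∑ i ∈ s, m i * G.turns e (q i)) (fun z hz => by
    rw [← h z hz]
    simp only [winding, Finset.mul_sum]
    push_cast
    simp only [Finset.mul_sum]
    rw [Finset.sum_comm]
    exact Finset.sum_congr rfl fun i _ => Finset.sum_congr rfl fun e _ => by ring)
  have hbr : ∀ e, ∀ i ∈ s, ∃ L : C(unitInterval, ℂ), (∀ t, exp (L t) = G.arc e t - q i) ∧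
      L 0 = log (G.pos (G.black e) - q i) ∧
      L 1 = log (G.pos (G.white e) - q i) + 2 * Real.pi * I * G.turns e (q i) := by
    intro e i hi
    have hne : ∀ t, G.arc e t ≠ q i := fun t ht =>
      hq i hi (range_arc_subset_drawing e ⟨t, ht⟩)
    obtain ⟨L, hL⟩ := exists_branch (G.arc e) (G.arc e).continuous (q i) hne
    have h0 : G.pos (G.black e) - q i ≠ 0 := by
      have := hne 0; rw [Path.source] at this; exact sub_ne_zero.2 this
    refine ⟨⟨fun t => L t - L 0 + log (G.pos (G.black e) - q i), by fun_prop⟩, fun t => ?_, ?_, ?_⟩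
    · simp only [ContinuousMap.coe_mk]
      rw [exp_add, exp_sub, hL, hL, exp_log h0, Path.source]
      field_simp
    · simp
    · have h1 := logChange_arc (G := G) (e := e) (p := q i) (fun ⟨t, ht⟩ => hne t ht)
      rw [logChange_eq _ _ L hL] at h1
      simp only [ContinuousMap.coe_mk]
      rw [h1]; ring
  choose! L hL hL0 hL1 using hbr
  set A : V → ℂ := fun v => ∑ i ∈ s, m i * log (G.pos v - q i) + 2 * Real.pi * I * M v
  let f : C(Σ _ : E, unitInterval, ℂ) :=
    ⟨fun x => ∑ i ∈ s, m i * L x.1 i x.2 + 2 * Real.pi * I * M (G.black x.1),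
      continuous_sigma fun e => by fun_prop⟩
  have hfe : ∀ x : Σ _ : E, unitInterval, exp (f x) = ∏ i ∈ s, (G.arc x.1 x.2 - q i) ^ m i := by
    intro x
    simp only [f, ContinuousMap.coe_mk]
    rw [exp_add, exp_sum, mul_comm (2 * Real.pi * I : ℂ), exp_int_mul_two_pi_mul_I, mul_one]
    exact Finset.prod_congr rfl fun i hi => by rw [exp_int_mul, hL _ _ hi]
  have hend : ∀ (e : E) (t : unitInterval), t = 0 ∨ t = 1 →
      ∃ v, G.arc e t = G.pos v ∧ f ⟨e, t⟩ = A v := by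
    rintro e t (rfl | rfl)
    · refine ⟨G.black e, Path.source _, ?_⟩
      simp only [f, A, ContinuousMap.coe_mk]
      exact congrArg (· + _) (Finset.sum_congr rfl fun i hi => by rw [hL0 e i hi])
    · refine ⟨G.white e, Path.target _, ?_⟩
      simp only [f, A, ContinuousMap.coe_mk]
      rw [Finset.sum_congr rfl fun i hi => by rw [hL1 e i hi]]
      have := congrArg (Int.cast : ℤ → ℂ) (hM e)
      push_cast at this
      simp only [mul_add, Finset.sum_add_distrib]
      have h2 : ∑ i ∈ s, (m i : ℂ) * (2 * Real.pi * I * G.turns e (q i)) =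
          2 * Real.pi * I * ∑ i ∈ s, (m i : ℂ) * G.turns e (q i) := by
        rw [Finset.mul_sum]; exact Finset.sum_congr rfl fun i _ => by ring
      rw [h2, this]; ring
  let Q : (Σ _ : E, unitInterval) → G.drawing := fun x =>
    ⟨G.arc x.1 x.2, range_arc_subset_drawing x.1 ⟨x.2, rfl⟩⟩
  have hQc : Continuous Q := continuous_sigma fun e =>
    Continuous.subtype_mk (G.arc e).continuous _
  have hQs : Function.Surjective Q := by
    rintro ⟨x, hx⟩
    have : ∃ e t, G.arc e t = x := by
      rcases hx with ⟨v, rfl⟩ | hx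
      · obtain ⟨e, rfl | rfl⟩ := hV v
        · exact ⟨e, 0, Path.source _⟩
        · exact ⟨e, 1, Path.target _⟩
      · obtain ⟨e, t, rfl⟩ := mem_iUnion.1 hx
        exact ⟨e, t, rfl⟩
    obtain ⟨e, t, rfl⟩ := this
    exact ⟨⟨e, t⟩, rfl⟩
  have hquot : IsQuotientMap (⟨Q, hQc⟩ : C(_, _)) := IsQuotientMap.of_surjective_continuous hQs hQc
  have hfac : Function.FactorsThrough f Q := by
    rintro ⟨e, t⟩ ⟨e', t'⟩ heq
    have heq' : G.arc e t = G.arc e' t' := congrArg Subtype.val heq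
    by_cases hee : e = e'
    · subst hee
      rw [G.arc_injective e heq']
    · obtain ⟨v, hv, hfv⟩ := hend e t (G.arc_eq_arc e e' t t' hee heq')
      obtain ⟨v', hv', hfv'⟩ := hend e' t' (G.arc_eq_arc e' e t' t (Ne.symm hee) heq'.symm)
      have : v = v' := G.pos_injective (by rw [← hv, ← hv', heq'])
      rw [hfv, hfv', this]
  obtain ⟨L', hL'⟩ := ContinuousMap.exists_restrict_eq
    (isCompact_drawing (G := G)).isClosed (hquot.lift f hfac)
  refine ⟨L', fun x hx => ?_⟩
  obtain ⟨y, hy⟩ := hQs ⟨x, hx⟩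
  have h1 : L' x = f y := by
    have := DFunLike.congr_fun hL' ⟨x, hx⟩
    rw [ContinuousMap.restrict_apply] at this
    rw [this, ← hy]
    exact DFunLike.congr_fun (hquot.lift_comp f hfac) y
  have h2 : G.arc y.1 y.2 = x := congrArg Subtype.val hy
  rw [h1, hfe, h2]

theorem frontier_component_subset {K : Set ℂ} (hK : IsClosed K) (p : ℂ) :
    frontier (connectedComponentIn Kᶜ p) ⊆ K := by
  intro x hx
  by_contra hxK
  have ho := hK.isOpen_compl.connectedComponentIn (x := x)
  have ho' := hK.isOpen_compl.connectedComponentIn (x := p)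
  have hmem := mem_connectedComponentIn (F := Kᶜ) hxK
  obtain ⟨y, hy1, hy2⟩ := mem_closure_iff.1 (frontier_subset_closure hx) _ ho hmem
  have h := (connectedComponentIn_eq hy1).trans (connectedComponentIn_eq hy2).symm
  rw [h] at hmem
  rw [frontier, ho'.interior_eq] at hx
  exact hx.2 hmem

/-- The windings around points of different bounded components are linearly independent: from a
relation that involves the bounded component `U` of `q i₀`, a continuous nonvanishing extension of
`(x - q i₀) ^ m i₀` from the outside of `U` to the plane is obtained. -/
theorem eq_zero_of_sum_winding_eq_zero [Fintype V] [Fintype E] (hG : G.toSimpleGraph.Connected)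
    (hV : ∀ v, ∃ e, G.black e = v ∨ G.white e = v) {ι : Type*} (s : Finset ι) (q : ι → ℂ)
    (m : ι → ℤ) (hq : ∀ i ∈ s, q i ∉ G.drawing)
    (h : ∀ z ∈ G.flows, ∑ i ∈ s, (m i : ℚ) * G.winding z (q i) = 0) {i₀ : ι} (hi₀ : i₀ ∈ s)
    (hb : Bornology.IsBounded (connectedComponentIn G.drawingᶜ (q i₀)))
    (hne : ∀ i ∈ s, i ≠ i₀ → q i ∉ connectedComponentIn G.drawingᶜ (q i₀)) : m i₀ = 0 := by
  classical
  obtain ⟨L, hL⟩ := exists_log_on_drawing hG hV s q m hq h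
  have hK : IsClosed G.drawing := isCompact_drawing.isClosed
  have hfr := frontier_component_subset hK (q i₀)
  have hqU := mem_connectedComponentIn (F := G.drawingᶜ) (hq i₀ hi₀)
  set U := connectedComponentIn G.drawingᶜ (q i₀)
  have hU : IsOpen U := hK.isOpen_compl.connectedComponentIn
  have hclU : closure U ⊆ U ∪ G.drawing := by
    rw [closure_eq_self_union_frontier]
    exact union_subset_union_right _ hfr
  have hne0 : ∀ x ∈ closure U, ∀ i ∈ s.erase i₀, x - q i ≠ 0 := by
    intro x hx i hi h0
    rw [sub_eq_zero] at h0
    rcases hclU hx with h1 | h1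
    · exact hne i (Finset.mem_of_mem_erase hi) (Finset.ne_of_mem_erase hi) (h0 ▸ h1)
    · exact hq i (Finset.mem_of_mem_erase hi) (h0 ▸ h1)
  have hne1 : ∀ x, x ∉ U → x - q i₀ ≠ 0 := fun x hx h0 => hx (sub_eq_zero.1 h0 ▸ hqU)
  set F : ℂ → ℂ := fun x => if x ∈ U then exp (L x) * ∏ i ∈ s.erase i₀, (x - q i) ^ (-m i)
    else (x - q i₀) ^ m i₀ with hFdef
  have hF : Continuous F := by
    refine continuous_if (fun x hx => ?_) ?_ ?_
    · have hx' : x ∈ frontier U := hx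
      rw [hL x (hfr hx), ← Finset.mul_prod_erase s _ hi₀, mul_assoc, ← Finset.prod_mul_distrib,
        Finset.prod_eq_one, mul_one]
      intro i hi
      rw [← zpow_add₀ (hne0 x (frontier_subset_closure hx') i hi), add_neg_cancel, zpow_zero]
    · refine L.continuous.cexp.continuousOn.mul (continuousOn_finsetProd _ fun i hi => ?_)
      exact ContinuousOn.zpow₀ (by fun_prop) _ fun x hx => Or.inl (hne0 x hx i hi)
    · have : closure {x | ¬ x ∈ U} = Uᶜ := hU.isClosed_compl.closure_eq
      rw [this]
      exact ContinuousOn.zpow₀ (by fun_prop) _ fun x hx => Or.inl (hne1 x hx)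
  have hF0 : ∀ x, F x ≠ 0 := by
    intro x
    simp only [hFdef]
    split_ifs with hx
    · exact mul_ne_zero (exp_ne_zero _) (Finset.prod_ne_zero_iff.2 fun i hi =>
        zpow_ne_zero _ (hne0 x (subset_closure hx) i hi))
    · exact zpow_ne_zero _ (hne1 x hx)
  obtain ⟨R, hR⟩ := hb.subset_closedBall (q i₀)
  refine eq_zero_of_eq_zpow_outside hF hF0 (p := q i₀) (R := R + 1) fun x hx => ?_
  have hxU : x ∉ U := fun hxU => by
    have h1 := hR hxU
    rw [Metric.mem_closedBall, dist_eq_norm] at h1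
    linarith
  simp only [hFdef, if_neg hxU]

theorem mem_component_of_winding_eq [Fintype V] [Fintype E] (hG : G.toSimpleGraph.Connected)
    (hV : ∀ v, ∃ e, G.black e = v ∨ G.white e = v) {p q : ℂ} (hp : p ∉ G.drawing)
    (hq : q ∉ G.drawing) (hb : Bornology.IsBounded (connectedComponentIn G.drawingᶜ p))
    (h : ∀ z ∈ G.flows, G.winding z p = G.winding z q) :
    q ∈ connectedComponentIn G.drawingᶜ p := by
  by_contra hcon
  have := eq_zero_of_sum_winding_eq_zero hG hV (Finset.univ : Finset (Fin 2)) ![p, q] ![1, -1]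
    (by intro i _; fin_cases i <;> assumption)
    (fun z hz => by simp [h z hz]) (Finset.mem_univ 0) hb
    (by intro i _ hi; fin_cases i; · exact absurd rfl hi
        · exact hcon)
  simp at this

/-- Pairwise different nonzero windings are linearly independent. -/
theorem eq_zero_of_sum_winding_eq_zero_of_ne [Fintype V] [Fintype E]
    (hG : G.toSimpleGraph.Connected)
    (hV : ∀ v, ∃ e, G.black e = v ∨ G.white e = v) {ι : Type*} (s : Finset ι) (q : ι → ℂ)
    (m : ι → ℤ) (hq : ∀ i ∈ s, q i ∉ G.drawing)
    (h : ∀ z ∈ G.flows, ∑ i ∈ s, (m i : ℚ) * G.winding z (q i) = 0) {i₀ : ι} (hi₀ : i₀ ∈ s)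
    (hb : ∃ z ∈ G.flows, G.winding z (q i₀) ≠ 0)
    (hne : ∀ i ∈ s, i ≠ i₀ → ∃ z ∈ G.flows, G.winding z (q i₀) ≠ G.winding z (q i)) :
    m i₀ = 0 := by
  refine eq_zero_of_sum_winding_eq_zero hG hV s q m hq h hi₀ ?_ ?_
  · obtain ⟨z, hz, hz0⟩ := hb
    by_contra hcon
    exact hz0 (winding_eq_zero_of_not_isBounded hz (hq _ hi₀) hcon)
  · intro i hi hii hmem
    obtain ⟨z, hz, hz0⟩ := hne i hi hii
    exact hz0 (winding_eq_of_mem_component hz (hq _ hi₀) hmem)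

/-- At most two windings occur near an edge `e`, that is, among windings that differ by multiples of
the weight of `e`. -/
theorem winding_eq_or_of_sub_eq [Fintype V] [Fintype E] (hG : G.toSimpleGraph.Connected)
    (hV : ∀ v, ∃ e, G.black e = v ∨ G.white e = v) {p q r : ℂ} (hp : p ∉ G.drawing)
    (hq : q ∉ G.drawing) (hr : r ∉ G.drawing) {e : E} {c c' : ℤ}
    {z : E → ℚ} (hz : z ∈ G.flows) (hze : z e ≠ 0)
    (h : ∀ z ∈ G.flows, G.winding z p - G.winding z q = z e * c)
    (h' : ∀ z ∈ G.flows, G.winding z r - G.winding z q = z e * c') :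
    c = 0 ∨ c' = 0 ∨ c = c' := by
  by_contra! hcon
  obtain ⟨hc, hc', hcc⟩ := hcon
  have hcq : (c : ℚ) ≠ 0 := by exact_mod_cast hc
  have hcq' : (c' : ℚ) ≠ 0 := by exact_mod_cast hc'
  have hccq : (c : ℚ) ≠ c' := by exact_mod_cast hcc
  have hpq : G.winding z p ≠ G.winding z q := fun h0 => by
    have := h z hz; rw [h0, sub_self] at this
    exact mul_ne_zero hze hcq this.symm
  have hrq : G.winding z r ≠ G.winding z q := fun h0 => by
    have := h' z hz; rw [h0, sub_self] at this
    exact mul_ne_zero hze hcq' this.symm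
  have hpr : G.winding z p ≠ G.winding z r := fun h0 => by
    have h1 := h' z hz
    rw [← h0, h z hz] at h1
    exact hccq (mul_left_cancel₀ hze h1)
  have hrel : ∀ z ∈ G.flows, ∑ i : Fin 3, ((![c', -c, c - c'] i : ℤ) : ℚ) *
      G.winding z (![p, r, q] i) = 0 := fun z hz => by
    have h1 := h z hz
    have h2 := h' z hz
    simp only [Fin.sum_univ_three, Matrix.cons_val_zero, Matrix.cons_val_one, Matrix.cons_val]
    push_cast
    linear_combination (c' : ℚ) * h1 - c * h2
  have hmem : ∀ i ∈ (Finset.univ : Finset (Fin 3)), ![p, r, q] i ∉ G.drawing := by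
    intro i _; fin_cases i <;> assumption
  -- at least one of the two windings is nonzero
  by_cases hp0 : G.winding z p = 0
  · have := eq_zero_of_sum_winding_eq_zero_of_ne hG hV Finset.univ _ _ hmem hrel
      (Finset.mem_univ 1) ⟨z, hz, fun h0 => hpr (hp0.trans h0.symm)⟩ (by
        intro i _ hi
        refine ⟨z, hz, ?_⟩
        fin_cases i
        · exact hpr.symm
        · exact absurd rfl hi
        · exact hrq)
    simp at this; exact hc this
  · have := eq_zero_of_sum_winding_eq_zero_of_ne hG hV Finset.univ _ _ hmem hrel
      (Finset.mem_univ 0) ⟨z, hz, hp0⟩ (by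
        intro i _ hi
        refine ⟨z, hz, ?_⟩
        fin_cases i
        · exact absurd rfl hi
        · exact hpr
        · exact hpq)
    simp at this; exact hc' this

/-! ### The two sides of an edge -/

theorem logChange_subpath {x y : ℂ} (γ : Path x y) (s t : unitInterval) {p : ℂ}
    (L : C(unitInterval, ℂ)) (hL : ∀ t, exp (L t) = γ t - p) :
    logChange (γ.subpath s t) p = L t - L s := by
  have h := logChange_eq (γ.subpath s t) p
    ⟨fun u => L (Icc.convexComb s t u), by fun_prop⟩ (fun u => by
      simp only [ContinuousMap.coe_mk]; rw [hL]; rfl)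
  rw [h]; simp

theorem logChange_eq_add_subpath {x y : ℂ} (γ : Path x y) (s t : unitInterval) {p : ℂ}
    (hp : p ∉ range γ) : logChange γ p = logChange (γ.subpath 0 s) p +
      logChange (γ.subpath s t) p + logChange (γ.subpath t 1) p := by
  obtain ⟨L, hL⟩ := exists_branch γ γ.continuous p fun u h => hp ⟨u, h⟩
  rw [logChange_eq γ p L hL, logChange_subpath γ _ _ L hL, logChange_subpath γ _ _ L hL,
    logChange_subpath γ _ _ L hL]
  ring

/-- The midpoint of the parameter interval. -/
noncomputable def midParam : unitInterval := ⟨1 / 2, by norm_num, by norm_num⟩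

variable (G)

/-- The drawing without the piece of the edge `e` between the parameters `s` and `t`. -/
def cutDrawing (e : E) (s t : unitInterval) : Set ℂ :=
  (⋃ e' ∈ {e' | e' ≠ e}, range (G.arc e')) ∪ (G.arc e '' Icc 0 s ∪ G.arc e '' Icc t 1)

/-- The component of the complement of `cutDrawing` that contains the piece of `e` that was cut
out. -/
def cutRegion (e : E) (s t : unitInterval) : Set ℂ :=
  connectedComponentIn (G.cutDrawing e s t)ᶜ (G.arc e (Icc.convexComb s t midParam))

variable {G}

theorem isClosed_cutDrawing [Finite E] (e : E) (s t : unitInterval) :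
    IsClosed (G.cutDrawing e s t) :=
  ((toFinite _).isClosed_biUnion fun e' _ => (isCompact_range (G.arc e').continuous).isClosed).union
    (((isCompact_Icc.image (G.arc e).continuous).isClosed).union
      ((isCompact_Icc.image (G.arc e).continuous).isClosed))

theorem arc_notMem_range_of_ne {e e' : E} (h : e' ≠ e) {u : unitInterval} (h0 : u ≠ 0)
    (h1 : u ≠ 1) : G.arc e u ∉ range (G.arc e') := by
  rintro ⟨v, hv⟩
  rcases G.arc_eq_arc e e' u v h.symm hv.symm with h | h
  exacts [h0 h, h1 h]

theorem arc_notMem_cutDrawing {e : E} {s t u : unitInterval} (hs : s < u) (ht : u < t) :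
    G.arc e u ∉ G.cutDrawing e s t := by
  have h0 : u ≠ 0 := (hs.trans_le' (unitInterval.nonneg' (t := s))).ne'
  have h1 : u ≠ 1 := (ht.trans_le (unitInterval.le_one' (t := t))).ne
  rintro (h | ⟨v, hv, hvu⟩ | ⟨v, hv, hvu⟩)
  · simp only [mem_iUnion] at h
    obtain ⟨e', he', h⟩ := h
    exact arc_notMem_range_of_ne he' h0 h1 h
  · rw [G.arc_injective e hvu] at hv
    exact hs.not_ge hv.2
  · rw [G.arc_injective e hvu] at hv
    exact ht.not_ge hv.1

theorem convexComb_half_mem {s t : unitInterval} (h : s < t) :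
    Icc.convexComb s t midParam ∈ Ioo s t := by
  have h' : (s : ℝ) < t := h
  constructor
  · change (s : ℝ) < (1 - (midParam : ℝ)) * s + (midParam : ℝ) * t
    simp only [midParam]; linarith
  · change (1 - (midParam : ℝ)) * s + (midParam : ℝ) * t < (t : ℝ)
    simp only [midParam]; linarith

theorem isPreconnected_Ioo_unitInterval (s t : unitInterval) : IsPreconnected (Ioo s t) :=
  ordConnected_Ioo.isPreconnected

theorem arc_mem_cutRegion {e : E} {s t u : unitInterval} (hs : s < u) (ht : u < t) :
    G.arc e u ∈ G.cutRegion e s t := by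
  have hm := convexComb_half_mem (hs.trans ht)
  refine IsPreconnected.subset_connectedComponentIn (s := G.arc e '' Ioo s t)
    ((isPreconnected_Ioo_unitInterval s t).image _ (G.arc e).continuous.continuousOn)
    ⟨_, hm, rfl⟩ ?_ ⟨u, ⟨hs, ht⟩, rfl⟩
  rintro _ ⟨v, hv, rfl⟩
  exact arc_notMem_cutDrawing hv.1 hv.2

theorem isOpen_cutRegion [Finite E] (e : E) (s t : unitInterval) : IsOpen (G.cutRegion e s t) :=
  (isClosed_cutDrawing e s t).isOpen_compl.connectedComponentIn

theorem disjoint_cutRegion (e : E) (s t : unitInterval) :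
    Disjoint (G.cutRegion e s t) (G.cutDrawing e s t) :=
  disjoint_left.2 fun _ hx => connectedComponentIn_subset _ _ hx

theorem cutDrawing_mono {e : E} {s t s' t' : unitInterval} (hs : s' ≤ s) (ht : t ≤ t') :
    G.cutDrawing e s' t' ⊆ G.cutDrawing e s t :=
  union_subset_union_right _ (union_subset_union (image_mono (Icc_subset_Icc_right hs))
    (image_mono (Icc_subset_Icc_left ht)))

theorem cutRegion_mono {e : E} {s t s' t' : unitInterval} (hst : s < t) (hs : s' ≤ s)
    (ht : t ≤ t') : G.cutRegion e s t ⊆ G.cutRegion e s' t' := by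
  have hm := convexComb_half_mem hst
  have h1 := arc_mem_cutRegion (G := G) (e := e) (hs.trans_lt hm.1) (hm.2.trans_le ht)
  have h2 := connectedComponentIn_eq h1
  rw [cutRegion.eq_def G e s' t', h2]
  exact connectedComponentIn_mono _ (compl_subset_compl.2 (cutDrawing_mono hs ht))

theorem exists_arc_eq (hV : ∀ v, ∃ e, G.black e = v ∨ G.white e = v) {x : ℂ} (hx : x ∈ G.drawing) :
    ∃ e t, G.arc e t = x := by
  rcases hx with ⟨v, rfl⟩ | hx
  · obtain ⟨e, rfl | rfl⟩ := hV v
    · exact ⟨e, 0, Path.source _⟩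
    · exact ⟨e, 1, Path.target _⟩
  · obtain ⟨e, t, rfl⟩ := mem_iUnion.1 hx
    exact ⟨e, t, rfl⟩

theorem mem_cutDrawing_or (hV : ∀ v, ∃ e, G.black e = v ∨ G.white e = v) (e : E)
    (s t : unitInterval) {x : ℂ} (hx : x ∈ G.drawing) :
    x ∈ G.cutDrawing e s t ∨ ∃ u, s < u ∧ u < t ∧ G.arc e u = x := by
  obtain ⟨e', u, rfl⟩ := exists_arc_eq hV hx
  by_cases he : e' = e
  · subst he
    rcases le_or_gt u s with h | h
    · exact Or.inl (Or.inr (Or.inl ⟨u, ⟨unitInterval.nonneg', h⟩, rfl⟩))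
    · rcases le_or_gt t u with h' | h'
      · exact Or.inl (Or.inr (Or.inr ⟨u, ⟨h', unitInterval.le_one'⟩, rfl⟩))
      · exact Or.inr ⟨u, h, h', rfl⟩
  · refine Or.inl (Or.inl ?_)
    simp only [mem_iUnion]
    exact ⟨e', he, u, rfl⟩

/-- Within the region around a piece of the edge `e`, the windings of all flows are determined by
that of a single flow of weight `1` on `e`. -/
theorem winding_sub_eq_mul [Fintype E] {e : E} {z₀ : E → ℚ} (hz₀ : z₀ ∈ G.flows) (he : z₀ e = 1)
    {s t : unitInterval} {p q : ℂ} (hp : p ∈ G.cutRegion e s t) (hq : q ∈ G.cutRegion e s t)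
    {z : E → ℚ} (hz : z ∈ G.flows) :
    G.winding z p - G.winding z q = z e * (G.winding z₀ p - G.winding z₀ q) := by
  have h := winding_eq_of_isPreconnected (z := z - z e • z₀)
    (Submodule.sub_mem _ hz (Submodule.smul_mem _ _ hz₀))
    (isPreconnected_connectedComponentIn (F := (G.cutDrawing e s t)ᶜ)) (fun e' he' =>
      disjoint_left.2 fun x hx hxe => (disjoint_cutRegion e s t).notMem_of_mem_left hx <| by
        refine Or.inl ?_
        simp only [mem_iUnion]
        refine ⟨e', fun h => he' ?_, hxe⟩
        have h' : e' = e := h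
        simp [h', he]) hp hq
  rw [winding_sub, winding_sub, winding_smul, winding_smul] at h
  linear_combination h

/-- There are points on the two sides of an edge that lies on a cycle; they can be joined off the
remainder of the drawing through any given piece of the edge. -/
theorem exists_winding_sub_eq [Fintype V] [Fintype E] (hG : G.toSimpleGraph.Connected)
    (hV : ∀ v, ∃ e, G.black e = v ∨ G.white e = v) {e : E} {z₀ : E → ℤ}
    (hz₀ : (fun e => (z₀ e : ℚ)) ∈ G.flows) (he : z₀ e = 1) {s t : unitInterval} (hst : s < t) :
    ∃ p q, p ∈ G.cutRegion e s t ∧ q ∈ G.cutRegion e s t ∧ p ∉ G.drawing ∧ q ∉ G.drawing ∧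
      ∀ z ∈ G.flows, G.winding z p - G.winding z q = z e := by
  classical
  set w : ℂ → ℤ := fun p => ∑ e, z₀ e * G.turns e p with hw
  have hwz : ∀ p, G.winding (fun e => (z₀ e : ℚ)) p = w p := fun p => by
    simp [winding, hw]
  have he' : (fun e => (z₀ e : ℚ)) e = 1 := by simp [he]
  have hsub : ∀ p ∈ G.cutRegion e s t, ∀ q ∈ G.cutRegion e s t, ∀ z ∈ G.flows,
      G.winding z p - G.winding z q = z e * ((w p - w q : ℤ) : ℚ) := by
    intro p hp q hq z hz
    rw [winding_sub_eq_mul hz₀ he' hp hq hz, hwz, hwz]; push_cast; rfl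
  -- a continuous logarithm of the ratio of the distances to the ends, off the rest of the drawing
  set ψ : ℂ → ℂ := fun p => -∑ e' ∈ Finset.univ.erase e, (z₀ e' : ℂ) * logChange (G.arc e') p -
    logChange ((G.arc e).subpath 0 s) p - logChange ((G.arc e).subpath t 1) p with hψ
  have hcut : ∀ p, p ∉ G.cutDrawing e s t →
      (∀ e', e' ≠ e → p ∉ range (G.arc e')) ∧ p ∉ range ((G.arc e).subpath 0 s) ∧
      p ∉ range ((G.arc e).subpath t 1) := by
    intro p hp
    refine ⟨fun e' hee hpe => hp (Or.inl ?_), fun h => hp (Or.inr (Or.inl ?_)),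
      fun h => hp (Or.inr (Or.inr ?_))⟩
    · simp only [mem_iUnion]; exact ⟨e', hee, hpe⟩
    · rwa [Path.range_subpath_of_le _ _ _ unitInterval.nonneg'] at h
    · rwa [Path.range_subpath_of_le _ _ _ unitInterval.le_one'] at h
  have hψc : ContinuousOn ψ (G.cutDrawing e s t)ᶜ := by
    refine ((continuousOn_finsetSum _ fun e' he' => ?_).neg.sub ?_).sub ?_
    · exact continuousOn_const.mul ((continuousOn_logChange (G.arc e').continuous).mono
        fun p hp => (hcut p hp).1 e' (Finset.ne_of_mem_erase he'))
    · exact (continuousOn_logChange (Path.continuous _)).mono fun p hp => (hcut p hp).2.1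
    · exact (continuousOn_logChange (Path.continuous _)).mono fun p hp => (hcut p hp).2.2
  have hψe : ∀ p, p ∉ G.cutDrawing e s t → exp (ψ p) =
      ((G.arc e).subpath s t 1 - p) / ((G.arc e).subpath s t 0 - p) := by
    intro p hp
    obtain ⟨h1, h2, h3⟩ := hcut p hp
    have hb : G.pos (G.black e) - p ≠ 0 := fun h => h2 ⟨0, by
      rw [Path.source, Path.source]; exact sub_eq_zero.1 h⟩
    have hwh : G.pos (G.white e) - p ≠ 0 := fun h => h3 ⟨1, by
      rw [Path.target, Path.target]; exact sub_eq_zero.1 h⟩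
    have hs0 : G.arc e s - p ≠ 0 := fun h => h2 ⟨1, by
      rw [Path.target]; exact sub_eq_zero.1 h⟩
    have ht0 : G.arc e t - p ≠ 0 := fun h => h3 ⟨0, by
      rw [Path.source]; exact sub_eq_zero.1 h⟩
    have hsum : ∑ e' ∈ Finset.univ.erase e, (z₀ e' : ℂ) * logChange (G.arc e') p =
        -(log (G.pos (G.white e) - p) - log (G.pos (G.black e) - p)) +
        (∑ e' ∈ Finset.univ.erase e, z₀ e' * G.turns e' p : ℤ) * (2 * Real.pi * I) := by
      have hz := sum_sub_of_mem_flows hz₀ (fun v => log (G.pos v - p))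
      rw [← Finset.add_sum_erase _ _ (Finset.mem_univ e)] at hz
      simp only [he, Int.cast_one, Rat.cast_one, one_mul, Rat.cast_intCast] at hz
      rw [Finset.sum_congr rfl fun e' he' => by
        rw [logChange_arc (h1 e' (Finset.ne_of_mem_erase he')), mul_add]]
      rw [Finset.sum_add_distrib]
      push_cast
      rw [Finset.sum_mul, Finset.sum_congr (s₁ := Finset.univ.erase e)
        (f := fun e' => (z₀ e' : ℂ) * (2 * Real.pi * I * G.turns e' p))
        (g := fun e' => (z₀ e' : ℂ) * G.turns e' p * (2 * Real.pi * I)) rfl fun e' _ => by ring]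
      linear_combination hz
    simp only [hψ]
    rw [hsum, exp_sub, exp_sub, neg_add, exp_add, neg_neg, exp_neg (((_ : ℤ) : ℂ) * _),
      exp_int_mul_two_pi_mul_I, exp_sub, exp_log hb, exp_log hwh, exp_logChange (Path.continuous _) h2,
      exp_logChange (Path.continuous _) h3]
    simp only [Path.source, Path.target]
    field_simp
  have hrange : ∀ p ∈ G.cutRegion e s t, p ∉ range ((G.arc e).subpath s t) → p ∉ G.drawing := by
    intro p hp hpr hpd
    rcases mem_cutDrawing_or hV e s t hpd with h | ⟨u, hu1, hu2, rfl⟩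
    · exact (disjoint_cutRegion e s t).notMem_of_mem_left hp h
    · rw [Path.range_subpath_of_le _ _ _ hst.le] at hpr
      exact hpr ⟨u, ⟨hu1.le, hu2.le⟩, rfl⟩
  have jump : ∀ (d : ℕ) (n : ℤ), 2 ≤ d →
      ∃ p ∈ G.cutRegion e s t, p ∉ G.drawing ∧ ¬ (d : ℤ) ∣ w p - n := by
    intro d n hd
    have h := not_forall_logChange_sub_eq ((G.arc e).subpath s t).continuous
      (isClosed_cutDrawing e s t) (F := G.cutRegion e s t) (ψ := ψ) (fun h => by
        rw [Path.source, Path.target] at h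
        exact hst.ne (G.arc_injective e h)) (isOpen_cutRegion e s t) (disjoint_cutRegion e s t)
      (fun u h0 h1 => by
        have hu : (G.arc e).subpath s t u ∈ G.arc e '' Icc s t := by
          rw [← Path.range_subpath_of_le _ _ _ hst.le]; exact ⟨u, rfl⟩
        obtain ⟨v, ⟨hv1, hv2⟩, hv⟩ := hu
        rw [Path.source] at h0
        rw [Path.target] at h1
        rw [← hv] at h0 h1 ⊢
        exact arc_mem_cutRegion (lt_of_le_of_ne hv1 fun h => h0 (by rw [h]))
          (lt_of_le_of_ne hv2 fun h => h1 (by rw [h]))) hψc hψe hd n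
    push Not at h
    obtain ⟨p, hp, hpr, hk⟩ := h
    have hpd := hrange p hp hpr
    refine ⟨p, hp, hpd, fun ⟨k, hk'⟩ => hk k ?_⟩
    have h1 := winding_eq_sum_logChange hz₀ (p := p) fun e _ h =>
      hpd (range_arc_subset_drawing e h)
    rw [hwz, ← Finset.add_sum_erase _ _ (Finset.mem_univ e)] at h1
    simp only [he, Int.cast_one, Rat.cast_one, one_mul, Rat.cast_intCast] at h1
    rw [logChange_eq_add_subpath (G.arc e) s t fun h => hpd (range_arc_subset_drawing e h)] at h1
    have h2 : (w p : ℂ) = n + d * k := by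
      have : w p = n + d * k := by linarith
      exact_mod_cast this
    rw [← h2]
    simp only [hψ]
    linear_combination -h1
  obtain ⟨p₀, hp₀, hp₀d, -⟩ := jump 2 0 le_rfl
  obtain ⟨p₁, hp₁, hp₁d, h1⟩ := jump 2 (w p₀) le_rfl
  have hc : w p₁ - w p₀ ≠ 0 := fun h => h1 (by simp [h])
  by_cases habs : (w p₁ - w p₀).natAbs = 1
  · rcases Int.natAbs_eq (w p₁ - w p₀) with h | h
    · refine ⟨p₁, p₀, hp₁, hp₀, hp₁d, hp₀d, fun z hz => ?_⟩
      rw [hsub _ hp₁ _ hp₀ z hz, h, habs]; simp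
    · refine ⟨p₀, p₁, hp₀, hp₁, hp₀d, hp₁d, fun z hz => ?_⟩
      rw [hsub _ hp₀ _ hp₁ z hz, ← neg_sub, h, habs]; simp
  · exfalso
    obtain ⟨p₂, hp₂, hp₂d, h2⟩ := jump (w p₁ - w p₀).natAbs (w p₀) (by omega)
    rw [Int.natAbs_dvd] at h2
    rcases winding_eq_or_of_sub_eq hG hV hp₁d hp₀d hp₂d hz₀ (e := e) (by simp [he])
      (hsub _ hp₁ _ hp₀) (hsub _ hp₂ _ hp₀) with h | h | h
    · exact hc h
    · exact h2 (by rw [h]; exact dvd_zero _)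
    · exact h2 (by rw [h])

/-! ### Faces and their boundaries -/

theorem isPreconnected_drawing (hG : G.toSimpleGraph.Connected)
    (hV : ∀ v, ∃ e, G.black e = v ∨ G.white e = v) : IsPreconnected G.drawing := by
  obtain ⟨r⟩ := hG.nonempty
  have harc : ∀ e, IsPreconnected (range (G.arc e)) := fun e =>
    isPreconnected_range (G.arc e).continuous
  have hv : ∀ v, ∃ t ⊆ G.drawing, G.pos r ∈ t ∧ G.pos v ∈ t ∧ IsPreconnected t := by
    intro v
    have hr := (SimpleGraph.reachable_iff_reflTransGen r v).1 (hG.preconnected r v)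
    induction hr with
    | refl => exact ⟨{G.pos r}, by simpa using pos_mem_drawing r, rfl, rfl, isPreconnected_singleton⟩
    | tail _ hadj ih =>
      obtain ⟨t, ht, h1, h2, h3⟩ := ih
      obtain ⟨e, ⟨rfl, rfl⟩ | ⟨rfl, rfl⟩⟩ := hadj
      · exact ⟨t ∪ range (G.arc e), union_subset ht (range_arc_subset_drawing e), Or.inl h1,
          Or.inr (pos_mem_range_white e), h3.union _ h2 (pos_mem_range_black e) (harc e)⟩
      · exact ⟨t ∪ range (G.arc e), union_subset ht (range_arc_subset_drawing e), Or.inl h1,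
          Or.inr (pos_mem_range_black e), h3.union _ h2 (pos_mem_range_white e) (harc e)⟩
  refine isPreconnected_of_forall (G.pos r) fun y hy => ?_
  obtain ⟨e, u, rfl⟩ := exists_arc_eq hV hy
  obtain ⟨t, ht, h1, h2, h3⟩ := hv (G.black e)
  exact ⟨t ∪ range (G.arc e), union_subset ht (range_arc_subset_drawing e), Or.inl h1,
    Or.inr ⟨u, rfl⟩, h3.union _ h2 (pos_mem_range_black e) (harc e)⟩

theorem Face.eq_component (f : G.Face) {p : ℂ} (hp : p ∈ f.1) :
    f.1 = connectedComponentIn G.drawingᶜ p := by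
  obtain ⟨q, hq, h⟩ := f.2.1
  rw [h] at hp ⊢
  exact connectedComponentIn_eq hp

theorem Face.notMem_drawing (f : G.Face) {p : ℂ} (hp : p ∈ f.1) : p ∉ G.drawing := by
  obtain ⟨q, hq, h⟩ := f.2.1
  rw [h] at hp
  exact connectedComponentIn_subset _ _ hp

theorem Face.eq_of_mem {f g : G.Face} {p : ℂ} (hf : p ∈ f.1) (hg : p ∈ g.1) : f = g :=
  Subtype.ext ((f.eq_component hf).trans (g.eq_component hg).symm)

theorem Face.isOpen [Finite V] [Finite E] (f : G.Face) : IsOpen f.1 := by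
  rw [f.eq_component f.point_mem]
  exact isCompact_drawing.isClosed.isOpen_compl.connectedComponentIn

theorem Face.isPreconnected (f : G.Face) : IsPreconnected f.1 := by
  rw [f.eq_component f.point_mem]
  exact isPreconnected_connectedComponentIn

theorem Face.frontier_subset [Finite V] [Finite E] (f : G.Face) : frontier f.1 ⊆ G.drawing := by
  rw [f.eq_component f.point_mem]
  exact frontier_component_subset isCompact_drawing.isClosed _

theorem Face.winding_eq [Fintype E] (f : G.Face) {z : E → ℚ} (hz : z ∈ G.flows) {p q : ℂ}
    (hp : p ∈ f.1) (hq : q ∈ f.1) : G.winding z p = G.winding z q :=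
  winding_eq_of_mem_component hz (f.notMem_drawing hp) (f.eq_component hp ▸ hq)

theorem exists_face_or_winding_eq_zero [Fintype E] [Finite V] {p : ℂ} (hp : p ∉ G.drawing) :
    (∃ f : G.Face, p ∈ f.1) ∨ ∀ z ∈ G.flows, G.winding z p = 0 := by
  by_cases hb : Bornology.IsBounded (connectedComponentIn G.drawingᶜ p)
  · exact Or.inl ⟨⟨_, ⟨p, hp, rfl⟩, hb⟩, mem_connectedComponentIn hp⟩
  · exact Or.inr fun z hz => winding_eq_zero_of_not_isBounded hz hp hb

variable (G)

/-- A connected graph without isolated vertices each of whose edges lies on a cycle, in the form that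
some integral flow has weight `1` on it. -/
structure IsBridgeless [Fintype E] : Prop where
  connected : G.toSimpleGraph.Connected
  exists_edge : ∀ v, ∃ e, G.black e = v ∨ G.white e = v
  exists_flow : ∀ e, ∃ z : E → ℤ, (fun e => (z e : ℚ)) ∈ G.flows ∧ z e = 1

variable {G}

theorem Face.mem_of_winding_eq [Fintype V] [Fintype E] (h : G.IsBridgeless) (f : G.Face) {p q : ℂ}
    (hp : p ∈ f.1) (hq : q ∉ G.drawing) (hz : ∀ z ∈ G.flows, G.winding z p = G.winding z q) :
    q ∈ f.1 := by
  have hf := f.eq_component hp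
  rw [hf]
  exact mem_component_of_winding_eq h.connected h.exists_edge (f.notMem_drawing hp) hq
    (hf ▸ f.2.2) hz

/-- The winding number around a point of the face, as a functional on the cycle space. -/
noncomputable def windingFunctional [Fintype E] (f : G.Face) :
    Module.Dual ℚ G.flows where
  toFun z := G.winding z f.point
  map_add' _ _ := winding_add _ _ _
  map_smul' _ _ := winding_smul _ _ _

namespace IsBridgeless

theorem exists_sides [Fintype V] [Fintype E] (h : G.IsBridgeless) (e : E) : ∃ p : ℂ × ℂ,
    p.1 ∈ G.cutRegion e 0 1 ∧ p.2 ∈ G.cutRegion e 0 1 ∧ p.1 ∉ G.drawing ∧ p.2 ∉ G.drawing ∧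
      ∀ z ∈ G.flows, G.winding z p.1 - G.winding z p.2 = z e := by
  obtain ⟨z, hz, hze⟩ := h.exists_flow e
  obtain ⟨p, q, hpq⟩ := exists_winding_sub_eq h.connected h.exists_edge hz hze
    (zero_lt_one : (0 : unitInterval) < 1)
  exact ⟨(p, q), hpq⟩

/-- A point next to the edge `e`, on its left when `e` is traversed from black to white. -/
noncomputable def left [Fintype V] [Fintype E] (h : G.IsBridgeless) (e : E) : ℂ :=
  (h.exists_sides e).choose.1

/-- A point next to the edge `e`, on its right when `e` is traversed from black to white. -/
noncomputable def right [Fintype V] [Fintype E] (h : G.IsBridgeless) (e : E) : ℂ :=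
  (h.exists_sides e).choose.2

variable [Fintype V] [Fintype E] (h : G.IsBridgeless)

theorem right_mem_cutRegion (e : E) : h.right e ∈ G.cutRegion e 0 1 :=
  (h.exists_sides e).choose_spec.2.1

theorem left_notMem_drawing (e : E) : h.left e ∉ G.drawing :=
  (h.exists_sides e).choose_spec.2.2.1

theorem right_notMem_drawing (e : E) : h.right e ∉ G.drawing :=
  (h.exists_sides e).choose_spec.2.2.2.1

theorem winding_left_sub_right (e : E) {z : E → ℚ} (hz : z ∈ G.flows) :
    G.winding z (h.left e) - G.winding z (h.right e) = z e :=
  (h.exists_sides e).choose_spec.2.2.2.2 z hz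

/-- There are only two sides of an edge. -/
theorem winding_eq_left_or_right {e : E} {p : ℂ} (hp : p ∈ G.cutRegion e 0 1)
    (hpd : p ∉ G.drawing) : (∀ z ∈ G.flows, G.winding z p = G.winding z (h.left e)) ∨
      ∀ z ∈ G.flows, G.winding z p = G.winding z (h.right e) := by
  obtain ⟨z₀, hz₀, he⟩ := h.exists_flow e
  have hsub : ∀ z ∈ G.flows, G.winding z p - G.winding z (h.right e) =
      z e * ((∑ e', z₀ e' * G.turns e' p - ∑ e', z₀ e' * G.turns e' (h.right e) : ℤ) : ℚ) := by
    intro z hz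
    rw [winding_sub_eq_mul hz₀ (by simp [he]) hp (h.right_mem_cutRegion e) hz]
    simp [winding]
  rcases winding_eq_or_of_sub_eq h.connected h.exists_edge (h.left_notMem_drawing e)
    (h.right_notMem_drawing e) hpd hz₀ (e := e) (by simp [he]) (c := 1)
    (fun z hz => by rw [h.winding_left_sub_right e hz]; simp) hsub with h1 | h1 | h1
  · omega
  · right; intro z hz
    have := hsub z hz; rw [h1] at this; simp at this; linarith
  · left; intro z hz
    have h2 := hsub z hz
    have h3 := h.winding_left_sub_right e hz
    rw [← h1] at h2; simp at h2; linarith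

theorem not_left_mem_and_right_mem (e : E) (f : G.Face) :
    ¬ (h.left e ∈ f.1 ∧ h.right e ∈ f.1) := by
  rintro ⟨h1, h2⟩
  obtain ⟨z, hz, hze⟩ := h.exists_flow e
  have h3 := h.winding_left_sub_right e hz
  rw [f.winding_eq hz h1 h2, sub_self] at h3
  simp [hze] at h3

/-- A face that accumulates at an inner point of an edge lies on one of its sides. -/
theorem left_mem_or_right_mem_of_mem_closure {e : E} {t : unitInterval} (h0 : 0 < t) (h1 : t < 1)
    {f : G.Face} (ht : G.arc e t ∈ closure f.1) : h.left e ∈ f.1 ∨ h.right e ∈ f.1 := by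
  obtain ⟨p, hp, hpf⟩ := mem_closure_iff.1 ht _ (isOpen_cutRegion e 0 1) (arc_mem_cutRegion h0 h1)
  rcases h.winding_eq_left_or_right hp (f.notMem_drawing hpf) with hw | hw
  · exact Or.inl (f.mem_of_winding_eq h hpf (h.left_notMem_drawing e) hw)
  · exact Or.inr (f.mem_of_winding_eq h hpf (h.right_notMem_drawing e) hw)

/-- The frontier of a face on a side of `e` meets every piece of `e`. -/
theorem exists_arc_mem_frontier {e : E} {f : G.Face} (hf : h.left e ∈ f.1 ∨ h.right e ∈ f.1)
    {s t : unitInterval} (hst : s < t) : ∃ u, s < u ∧ u < t ∧ G.arc e u ∈ frontier f.1 := by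
  obtain ⟨z₀, hz₀, he⟩ := h.exists_flow e
  have he' : ((z₀ e : ℤ) : ℚ) = 1 := by simp [he]
  obtain ⟨p, q, hp, hq, hpd, hqd, hpq⟩ :=
    exists_winding_sub_eq h.connected h.exists_edge hz₀ he hst
  have hmono := cutRegion_mono (G := G) (e := e) hst (unitInterval.nonneg' (t := s))
    (unitInterval.le_one' (t := t))
  have e1 := hpq _ hz₀
  have e2 := h.winding_left_sub_right e hz₀
  have hp' : ∀ z ∈ G.flows, G.winding z p = G.winding z (h.left e) := by
    rcases h.winding_eq_left_or_right (hmono hp) hpd with h1 | h1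
    · exact h1
    · exfalso
      have e3 := h1 _ hz₀
      rcases h.winding_eq_left_or_right (hmono hq) hqd with h2 | h2 <;> have e4 := h2 _ hz₀ <;>
      simp only [he'] at e1 e2 <;> linarith
  have hq' : ∀ z ∈ G.flows, G.winding z q = G.winding z (h.right e) := by
    intro z hz
    have := hpq z hz
    have := h.winding_left_sub_right e hz
    have := hp' z hz
    linarith
  -- one of `p` and `q` is in the face, and the other one is not
  have hxy : ∃ x ∈ G.cutRegion e s t, x ∈ f.1 ∧ ∃ y ∈ G.cutRegion e s t, y ∉ closure f.1 := by
    have hcl : ∀ y, y ∉ G.drawing → y ∉ f.1 → y ∉ closure f.1 := fun y hy hyf hyc => by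
      rw [closure_eq_self_union_frontier] at hyc
      exact hyc.elim hyf fun h => hy (f.frontier_subset h)
    have hnot := h.not_left_mem_and_right_mem e f
    rcases hf with hl | hr
    · have hpf := f.mem_of_winding_eq h hl hpd fun z hz => (hp' z hz).symm
      refine ⟨p, hp, hpf, q, hq, hcl q hqd fun hqf => hnot ⟨hl, ?_⟩⟩
      exact f.mem_of_winding_eq h hqf (h.right_notMem_drawing e) hq'
    · have hqf := f.mem_of_winding_eq h hr hqd fun z hz => (hq' z hz).symm
      refine ⟨q, hq, hqf, p, hp, hcl p hpd fun hpf => hnot ⟨?_, hr⟩⟩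
      exact f.mem_of_winding_eq h hpf (h.left_notMem_drawing e) hp'
  obtain ⟨x, hx, hxf, y, hy, hyf⟩ := hxy
  have hconn : IsPreconnected (G.cutRegion e s t) := isPreconnected_connectedComponentIn
  have hfr : ∃ x ∈ G.cutRegion e s t, x ∈ frontier f.1 := by
    by_contra! hcon
    obtain ⟨w, -, hw1, hw2⟩ := hconn _ _ f.isOpen isClosed_closure.isOpen_compl (fun w hw => by
      by_cases hwc : w ∈ closure f.1
      · rw [closure_eq_self_union_frontier] at hwc
        exact hwc.elim Or.inl fun h => absurd h (hcon w hw)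
      · exact Or.inr hwc) ⟨x, hx, hxf⟩ ⟨y, hy, hyf⟩
    exact hw2 (subset_closure hw1)
  obtain ⟨w, hw, hwf⟩ := hfr
  rcases mem_cutDrawing_or h.exists_edge e s t (f.frontier_subset hwf) with h1 | ⟨u, h1, h2, rfl⟩
  · exact absurd h1 ((disjoint_cutRegion e s t).notMem_of_mem_left hw)
  · exact ⟨u, h1, h2, hwf⟩

theorem range_arc_subset_frontier {e : E} {f : G.Face}
    (hf : h.left e ∈ f.1 ∨ h.right e ∈ f.1) : range (G.arc e) ⊆ frontier f.1 := by
  have hclosed : IsClosed (G.arc e ⁻¹' frontier f.1) :=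
    isClosed_frontier.preimage (G.arc e).continuous
  have hdense : Dense (G.arc e ⁻¹' frontier f.1) := by
    rw [dense_iff_exists_between]
    intro s t hst
    obtain ⟨u, h1, h2, h3⟩ := h.exists_arc_mem_frontier hf hst
    exact ⟨u, h3, h1, h2⟩
  rw [range_subset_iff]
  intro t
  have : t ∈ closure (G.arc e ⁻¹' frontier f.1) := hdense t
  rwa [hclosed.closure_eq] at this

theorem linearIndependent_windingFunctional (h : G.IsBridgeless) :
    LinearIndependent ℚ (windingFunctional : G.Face → Module.Dual ℚ G.flows) := by
  rw [← LinearIndependent.iff_fractionRing ℤ ℚ, linearIndependent_iff']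
  intro s m hm f hf
  refine eq_zero_of_sum_winding_eq_zero h.connected h.exists_edge s (fun f => f.point) m
    (fun f _ => f.notMem_drawing f.point_mem) (fun z hz => ?_) hf ?_ ?_
  · have := LinearMap.congr_fun hm ⟨z, hz⟩
    simpa [LinearMap.sum_apply, windingFunctional] using this
  · rw [← f.eq_component f.point_mem]; exact f.2.2
  · intro g _ hgf hmem
    rw [← f.eq_component f.point_mem] at hmem
    exact hgf (Face.eq_of_mem g.point_mem hmem)

theorem finite_face (h : G.IsBridgeless) : Finite G.Face :=
  h.linearIndependent_windingFunctional.finite_of_isNoetherian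

/-- The boundary of a face as a flow: it winds once around the face, and not around the others. -/
theorem exists_faceFlow (h : G.IsBridgeless) (f : G.Face) : ∃ z ∈ G.flows, G.winding z f.point = 1 ∧
    ∀ g : G.Face, g ≠ f → G.winding z g.point = 0 := by
  have hli := h.linearIndependent_windingFunctional
  obtain ⟨Φ, hΦ⟩ := LinearMap.exists_extend (Finsupp.lapply f ∘ₗ hli.repr)
  have hΦ' : ∀ g, Φ (windingFunctional g) = Finsupp.single g (1 : ℚ) f := fun g => by
    have hg : windingFunctional g ∈ Submodule.span ℚ (range (windingFunctional (G := G))) :=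
      Submodule.subset_span ⟨g, rfl⟩
    have := LinearMap.congr_fun hΦ ⟨_, hg⟩
    rw [LinearMap.comp_apply, LinearMap.comp_apply, hli.repr_eq_single g ⟨_, hg⟩ rfl] at this
    exact this
  set z := (Module.evalEquiv ℚ G.flows).symm Φ
  have hz : ∀ g : G.Face, G.winding z g.point = Finsupp.single g (1 : ℚ) f := fun g => by
    rw [← hΦ' g]
    have : Module.evalEquiv ℚ G.flows z = Φ := LinearEquiv.apply_symm_apply _ _
    rw [← this]; rfl
  refine ⟨z, z.2, by rw [hz]; simp, fun g hg => by rw [hz]; simp [hg]⟩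

/-- The boundary of a face as a flow, oriented counterclockwise. -/
noncomputable def faceFlow (h : G.IsBridgeless) (f : G.Face) : E → ℚ := (h.exists_faceFlow f).choose

theorem faceFlow_mem (f : G.Face) : h.faceFlow f ∈ G.flows := (h.exists_faceFlow f).choose_spec.1

theorem winding_faceFlow_of_mem {f : G.Face} {p : ℂ} (hp : p ∈ f.1) :
    G.winding (h.faceFlow f) p = 1 := by
  rw [f.winding_eq (h.faceFlow_mem f) hp f.point_mem]
  exact (h.exists_faceFlow f).choose_spec.2.1

theorem winding_faceFlow_of_notMem {f : G.Face} {p : ℂ} (hp : p ∉ f.1) (hpd : p ∉ G.drawing) :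
    G.winding (h.faceFlow f) p = 0 := by
  rcases exists_face_or_winding_eq_zero hpd with ⟨g, hg⟩ | h0
  · rw [g.winding_eq (h.faceFlow_mem f) hg g.point_mem]
    exact (h.exists_faceFlow f).choose_spec.2.2 g fun hgf => hp (hgf ▸ hg)
  · exact h0 _ (h.faceFlow_mem f)

open Classical in
theorem faceFlow_apply (f : G.Face) (e : E) : h.faceFlow f e =
    (if h.left e ∈ f.1 then 1 else 0) - (if h.right e ∈ f.1 then 1 else 0) := by
  rw [← h.winding_left_sub_right e (h.faceFlow_mem f)]
  congr 1 <;> split_ifs with h1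
  · exact h.winding_faceFlow_of_mem h1
  · exact h.winding_faceFlow_of_notMem h1 (h.left_notMem_drawing e)
  · exact h.winding_faceFlow_of_mem h1
  · exact h.winding_faceFlow_of_notMem h1 (h.right_notMem_drawing e)

theorem exists_side_mem (f : G.Face) : ∃ e, h.left e ∈ f.1 ∨ h.right e ∈ f.1 := by
  classical
  by_contra! hcon
  have h1 := h.winding_faceFlow_of_mem f.point_mem
  have h2 : h.faceFlow f = 0 := by
    ext e
    rw [h.faceFlow_apply, if_neg (hcon e).1, if_neg (hcon e).2]; simp
  rw [h2] at h1
  simp [winding] at h1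

theorem isPreconnected_frontier (h : G.IsBridgeless) (f : G.Face) : IsPreconnected (frontier f.1) :=
  isPreconnected_frontier_component (isPreconnected_drawing h.connected h.exists_edge) f.isOpen
    f.isPreconnected (disjoint_left.2 fun _ hx => f.notMem_drawing hx) f.frontier_subset

/-- The frontier of a face consists of the edges with the face on one side. A vertex on none of these
edges would be isolated in the frontier, which is connected. -/
theorem frontier_eq (f : G.Face) : frontier f.1 =
    ⋃ e ∈ {e | h.left e ∈ f.1 ∨ h.right e ∈ f.1}, range (G.arc e) := by
  set Q := ⋃ e ∈ {e | h.left e ∈ f.1 ∨ h.right e ∈ f.1}, range (G.arc e) with hQ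
  have hQf : Q ⊆ frontier f.1 := iUnion₂_subset fun e he => h.range_arc_subset_frontier he
  have hQc : IsClosed Q :=
    (toFinite _).isClosed_biUnion fun e' _ => (isCompact_range (G.arc e').continuous).isClosed
  refine Subset.antisymm (fun x hx => ?_) hQf
  by_contra hxQ
  set T : Set ℂ := range G.pos \ Q
  have hT : IsClosed T := ((finite_range _).subset sdiff_subset).isClosed
  have hcov : frontier f.1 ⊆ Q ∪ T := by
    intro y hy
    by_cases hyQ : y ∈ Q
    · exact Or.inl hyQ
    · refine Or.inr ⟨?_, hyQ⟩
      obtain ⟨e, t, rfl⟩ := exists_arc_eq h.exists_edge (f.frontier_subset hy)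
      rcases eq_or_ne t 0 with rfl | h0
      · exact ⟨G.black e, (Path.source _).symm⟩
      rcases eq_or_ne t 1 with rfl | h1
      · exact ⟨G.white e, (Path.target _).symm⟩
      refine absurd ?_ hyQ
      simp only [hQ, mem_iUnion]
      exact ⟨e, h.left_mem_or_right_mem_of_mem_closure (unitInterval.pos_iff_ne_zero.2 h0)
        (unitInterval.lt_one_iff_ne_one.2 h1) (frontier_subset_closure hy), t, rfl⟩
  obtain ⟨e, he⟩ := h.exists_side_mem f
  have heQ : G.arc e 0 ∈ Q := by
    simp only [hQ, mem_iUnion]; exact ⟨e, he, 0, rfl⟩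
  obtain ⟨y, -, hy1, hy2⟩ := isPreconnected_closed_iff.1 (h.isPreconnected_frontier f) Q T hQc hT
    hcov ⟨_, hQf heQ, heQ⟩ ⟨x, hx, (hcov hx).resolve_left hxQ⟩
  exact hy2.2 hy1

end IsBridgeless

/-! ### The cycles of the symmetric difference of two dimers -/

open Classical in
/-- The indicator function of a set of edges. -/
noncomputable def edgeIndicator (S : Finset E) (e : E) : ℚ := if e ∈ S then 1 else 0

theorem edgeIndicator_nonneg (S : Finset E) (e : E) : 0 ≤ edgeIndicator S e := by
  unfold edgeIndicator; split_ifs <;> simp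

theorem edgeIndicator_le_one (S : Finset E) (e : E) : edgeIndicator S e ≤ 1 := by
  unfold edgeIndicator; split_ifs <;> simp

theorem edgeIndicator_of_mem {S : Finset E} {e : E} (h : e ∈ S) : edgeIndicator S e = 1 :=
  if_pos h

theorem edgeIndicator_of_notMem {S : Finset E} {e : E} (h : e ∉ S) : edgeIndicator S e = 0 :=
  if_neg h

namespace Dimer

/-- The edge of a dimer at a vertex. -/
noncomputable def edgeAt (M : G.Dimer) (v : V) : E := (M.perfect v).choose

theorem edgeAt_mem (M : G.Dimer) (v : V) : M.edgeAt v ∈ M.edges := (M.perfect v).choose_spec.1.1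

theorem eq_edgeAt (M : G.Dimer) {e : E} {v : V} (he : e ∈ M.edges)
    (hv : G.black e = v ∨ G.white e = v) : e = M.edgeAt v :=
  (M.perfect v).choose_spec.2 e ⟨he, hv⟩

theorem eq_of_mem (M : G.Dimer) {e e' : E} {v : V} (he : e ∈ M.edges) (he' : e' ∈ M.edges)
    (hv : G.black e = v ∨ G.white e = v) (hv' : G.black e' = v ∨ G.white e' = v) : e = e' :=
  (M.eq_edgeAt he hv).trans (M.eq_edgeAt he' hv').symm

theorem black_edgeAt (M : G.Dimer) {v : V} (hv : G.IsBlack v) : G.black (M.edgeAt v) = v := by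
  rcases (M.perfect v).choose_spec.1.2 with h | h
  · exact h
  · exact absurd hv (h ▸ G.not_isBlack_white _)

theorem white_edgeAt (M : G.Dimer) {v : V} (hv : ¬ G.IsBlack v) : G.white (M.edgeAt v) = v := by
  rcases (M.perfect v).choose_spec.1.2 with h | h
  · exact absurd (h ▸ G.isBlack_black _) hv
  · exact h

theorem sum_black [Fintype E] [DecidableEq V] (M : G.Dimer) (v : V) :
    ∑ e, (if G.black e = v then edgeIndicator M.edges e else 0) =
      open Classical in if G.IsBlack v then 1 else 0 := by
  classical
  split_ifs with hv
  · rw [Finset.sum_eq_single (M.edgeAt v)]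
    · rw [if_pos (M.black_edgeAt hv), edgeIndicator_of_mem (M.edgeAt_mem v)]
    · intro e _ he
      split_ifs with hb
      · exact edgeIndicator_of_notMem fun h => he (M.eq_edgeAt h (Or.inl hb))
      · rfl
    · simp
  · exact Finset.sum_eq_zero fun e _ => if_neg fun h : G.black e = v => hv (h ▸ G.isBlack_black e)

theorem sum_white [Fintype E] [DecidableEq V] (M : G.Dimer) (v : V) :
    ∑ e, (if G.white e = v then edgeIndicator M.edges e else 0) =
      open Classical in if G.IsBlack v then 0 else 1 := by
  classical
  split_ifs with hv
  · exact Finset.sum_eq_zero fun e _ => if_neg fun h : G.white e = v => G.not_isBlack_white e (h ▸ hv)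
  · rw [Finset.sum_eq_single (M.edgeAt v)]
    · rw [if_pos (M.white_edgeAt hv), edgeIndicator_of_mem (M.edgeAt_mem v)]
    · intro e _ he
      split_ifs with hb
      · exact edgeIndicator_of_notMem fun h => he (M.eq_edgeAt h (Or.inr hb))
      · rfl
    · simp

end Dimer

/-- The flow `M - N`, for two dimers `M` and `N`. -/
noncomputable def dimerFlow (M N : G.Dimer) : E → ℚ :=
  edgeIndicator M.edges - edgeIndicator N.edges

theorem sum_ite_sub [Fintype E] (p : E → Prop) [DecidablePred p] (x y : E → ℚ) :
    ∑ e, (if p e then (x - y) e else 0) =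
      ∑ e, (if p e then x e else 0) - ∑ e, (if p e then y e else 0) := by
  rw [← Finset.sum_sub_distrib]
  exact Finset.sum_congr rfl fun e _ => by split_ifs <;> simp

theorem dimerFlow_mem [Fintype E] (M N : G.Dimer) : dimerFlow M N ∈ G.flows := by
  classical
  rw [mem_flows]
  constructor <;> intro v <;> rw [dimerFlow, sum_ite_sub]
  · rw [M.sum_black, N.sum_black, sub_self]
  · rw [M.sum_white, N.sum_white, sub_self]

theorem dimerFlow_self (M : G.Dimer) : dimerFlow M M = 0 := sub_self _

theorem dimerFlow_add (M N L : G.Dimer) : dimerFlow M N + dimerFlow N L = dimerFlow M L :=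
  sub_add_sub_cancel _ _ _

theorem neg_dimerFlow (M N : G.Dimer) : -dimerFlow M N = dimerFlow N M := neg_sub _ _

theorem eq_of_dimerFlow_eq_zero {M N : G.Dimer} (h : dimerFlow M N = 0) : M = N := by
  ext e
  have h1 : edgeIndicator M.edges e = edgeIndicator N.edges e := by
    have := congrFun h e
    simpa [dimerFlow, sub_eq_zero] using this
  by_cases hM : e ∈ M.edges <;> by_cases hN : e ∈ N.edges <;> simp_all [edgeIndicator]

namespace IsDirectedCycle

variable {P N : Finset E}

theorem flow_mem [Fintype E] (h : G.IsDirectedCycle P N) :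
    edgeIndicator P - edgeIndicator N ∈ G.flows := by
  classical
  obtain ⟨n, hn, b, w, h1, h2, h3, h4, -, h6, h7⟩ := h
  have : NeZero n := ⟨hn.ne'⟩
  have hb : Function.Injective b := fun i j hij => h3 (by simp [hij])
  have hw : Function.Injective w := fun i j hij => h4 (by simp [h1, hij])
  have eP : P = Finset.univ.image b := by ext e; simp [h6]
  have eN : N = Finset.univ.image w := by ext e; simp [h7]
  have hsum : ∀ (u : ZMod n → E), Function.Injective u → ∀ (p : E → Prop) [DecidablePred p],
      ∑ e, (if p e then edgeIndicator (Finset.univ.image u) e else 0) =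
        ∑ i, if p (u i) then (1 : ℚ) else 0 := by
    intro u hu p _
    rw [← Finset.sum_image (s := Finset.univ) (g := u) (f := fun e => if p e then (1 : ℚ) else 0)
      hu.injOn, ← Finset.sum_subset (Finset.subset_univ (Finset.univ.image u))]
    · exact Finset.sum_congr rfl fun e he => by rw [edgeIndicator_of_mem he]
    · intro e _ he
      rw [edgeIndicator_of_notMem he]; simp
  rw [mem_flows]
  constructor <;> intro v <;> rw [sum_ite_sub, eP, eN, hsum b hb, hsum w hw, sub_eq_zero]
  · simp only [h2]
    exact (Equiv.sum_comp (Equiv.addRight (1 : ZMod n))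
      (fun i => if G.black (b i) = v then (1 : ℚ) else 0)).symm
  · simp only [h1]

theorem wind_eq [Fintype E] (h : G.IsDirectedCycle P N) {p : ℂ} (hp : p ∉ G.drawing) :
    (G.wind P N p : ℚ) = G.winding (edgeIndicator P - edgeIndicator N) p := by
  classical
  have hp' : ∀ e t, G.arc e t ≠ p := fun e t ht => hp (range_arc_subset_drawing e ⟨t, ht⟩)
  obtain ⟨k, hk⟩ := G.exists_int_winding h p hp'
  have h1 : G.wind P N p = k := by
    rw [wind, hk, mul_div_cancel_right₀ _ (by positivity), round_intCast]
  have h2 := winding_eq_sum_logChange h.flow_mem (p := p) fun e _ he =>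
    hp (range_arc_subset_drawing e he)
  have h3 : (∑ e, (((edgeIndicator P - edgeIndicator N) e : ℚ) : ℂ) * logChange (G.arc e) p).im =
      ∑ e ∈ P, argChange (G.arc e) p - ∑ e ∈ N, argChange (G.arc e) p := by
    have hS : ∀ S : Finset E, ∑ e ∈ S, argChange (G.arc e) p =
        ∑ e, (edgeIndicator S e : ℝ) * argChange (G.arc e) p := fun S => by
      rw [← Finset.sum_subset (Finset.subset_univ S)]
      · exact Finset.sum_congr rfl fun e he => by rw [edgeIndicator_of_mem he]; simp
      · intro e _ he
        rw [edgeIndicator_of_notMem he]; simp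
    rw [hS, hS, ← Finset.sum_sub_distrib, im_sum]
    refine Finset.sum_congr rfl fun e _ => ?_
    rw [← ofReal_ratCast, im_ofReal_mul, logChange_im]
    simp only [Pi.sub_apply, Rat.cast_sub]
    ring
  have h4 := congrArg Complex.im h2
  rw [h3, hk] at h4
  have h5 : (2 * Real.pi * I * (G.winding (edgeIndicator P - edgeIndicator N) p : ℂ)) =
      ((2 * Real.pi * (G.winding (edgeIndicator P - edgeIndicator N) p : ℝ) : ℝ) : ℂ) * I := by
    push_cast; ring
  rw [h5, im_ofReal_mul, I_im, mul_one] at h4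
  have h6 : (G.winding (edgeIndicator P - edgeIndicator N) p : ℝ) = k := by
    have : (2 * Real.pi : ℝ) ≠ 0 := by positivity
    apply mul_left_cancel₀ this
    linarith
  rw [h1]
  exact_mod_cast h6.symm

end IsDirectedCycle

/-- The permutation of the edges of the dimer `M` that leads from an edge, through the edge of `Z` at
its white end, to the next edge of `M`. Its orbits are the cycles of `M △ Z`, and the common edges
of `M` and `Z`. -/
noncomputable def nextEdge (M Z : G.Dimer) (e : M.edges) : M.edges :=
  ⟨M.edgeAt (G.black (Z.edgeAt (G.white e.1))), M.edgeAt_mem _⟩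

theorem nextEdge_injective (M Z : G.Dimer) : Function.Injective (nextEdge M Z) := by
  intro e e' h
  have h1 : M.edgeAt (G.black (Z.edgeAt (G.white e.1))) =
      M.edgeAt (G.black (Z.edgeAt (G.white e'.1))) := congrArg Subtype.val h
  have h2 := congrArg G.black h1
  rw [M.black_edgeAt (G.isBlack_black _), M.black_edgeAt (G.isBlack_black _)] at h2
  have h3 := Z.eq_of_mem (Z.edgeAt_mem _) (Z.edgeAt_mem _) (Or.inl h2) (Or.inl rfl)
  have h4 := congrArg G.white h3
  rw [Z.white_edgeAt (G.not_isBlack_white _), Z.white_edgeAt (G.not_isBlack_white _)] at h4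
  exact Subtype.ext (M.eq_of_mem e.2 e'.2 (Or.inr h4) (Or.inr rfl))

theorem nextEdge_notMem {M Z : G.Dimer} {e : M.edges} (he : e.1 ∉ Z.edges) :
    (nextEdge M Z e).1 ∉ Z.edges := by
  intro h
  have h1 : (nextEdge M Z e).1 = Z.edgeAt (G.white e.1) :=
    Z.eq_of_mem h (Z.edgeAt_mem _) (Or.inl (M.black_edgeAt (G.isBlack_black _))) (Or.inl rfl)
  have h2 : (nextEdge M Z e).1 = e.1 := M.eq_of_mem (nextEdge M Z e).2 e.2
    (Or.inr (by rw [h1, Z.white_edgeAt (G.not_isBlack_white _)])) (Or.inr rfl)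
  exact he (h2 ▸ h)

theorem mem_cycles [Fintype E] {M Z : G.Dimer} {C : Finset E × Finset E} :
    C ∈ cycles M Z ↔ G.IsDirectedCycle C.1 C.2 ∧ (∀ e ∈ C.1, e ∈ M.edges ∧ e ∉ Z.edges) ∧
      ∀ e ∈ C.2, e ∈ Z.edges ∧ e ∉ M.edges := by
  simp only [cycles, Finset.mem_filter, Finset.mem_univ, true_and, Finset.subset_iff,
    Finset.mem_sdiff]

theorem exists_mem_cycles [Fintype E] {M Z : G.Dimer} {e : E} (heM : e ∈ M.edges)
    (heZ : e ∉ Z.edges) : ∃ C ∈ cycles M Z, e ∈ C.1 := by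
  classical
  set τ := nextEdge M Z
  set x : M.edges := ⟨e, heM⟩
  have hper : x ∈ Function.periodicPts τ := (nextEdge_injective M Z).mem_periodicPts x
  set n := Function.minimalPeriod τ x
  have hn : 0 < n := Function.minimalPeriod_pos_of_mem_periodicPts hper
  have : NeZero n := ⟨hn.ne'⟩
  set b : ZMod n → E := fun i => (τ^[i.val] x).1
  set w : ZMod n → E := fun i => Z.edgeAt (G.white (b i))
  have hbM : ∀ i, b i ∈ M.edges := fun i => (τ^[i.val] x).2
  have hbZ : ∀ i, b i ∉ Z.edges := fun i => by
    have : ∀ k, (τ^[k] x).1 ∉ Z.edges := fun k => by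
      induction k with
      | zero => exact heZ
      | succ k ih => rw [Function.iterate_succ_apply']; exact nextEdge_notMem ih
    exact this _
  have hwZ : ∀ i, w i ∈ Z.edges := fun i => Z.edgeAt_mem _
  have hbw : ∀ i, G.white (b i) = G.white (w i) := fun i =>
    (Z.white_edgeAt (G.not_isBlack_white _)).symm
  have hb1 : ∀ i, b (i + 1) = M.edgeAt (G.black (w i)) := fun i => by
    have h1 : τ^[(i + 1).val] x = τ^[i.val + 1] x := by
      rw [ZMod.val_add, ZMod.val_one_eq_one_mod, Nat.add_mod_mod,
        Function.iterate_mod_minimalPeriod_eq]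
    simp only [b, h1, Function.iterate_succ_apply']
    rfl
  have hbinj : Function.Injective b := fun i j hij => by
    have h1 := Function.iterate_injOn_Iio_minimalPeriod (f := τ) (x := x) (ZMod.val_lt i)
      (ZMod.val_lt j) (Subtype.ext hij)
    exact ZMod.val_injective n h1
  have hwM : ∀ i, w i ∉ M.edges := fun i hi => by
    have : w i = b i := M.eq_of_mem hi (hbM i) (Or.inr (hbw i).symm) (Or.inr rfl)
    exact hbZ i (this ▸ hwZ i)
  refine ⟨(Finset.univ.image b, Finset.univ.image w), mem_cycles.2 ⟨⟨n, hn, b, w, hbw, ?_, ?_, ?_,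
    fun i h => hbZ i (h ▸ hwZ i), fun e => by simp, fun e => by simp⟩, ?_, ?_⟩, ?_⟩
  · intro i
    rw [hb1, M.black_edgeAt (G.isBlack_black _)]
  · intro i j hij
    exact hbinj (M.eq_of_mem (hbM i) (hbM j) (Or.inl hij) (Or.inl rfl))
  · intro i j hij
    exact hbinj (M.eq_of_mem (hbM i) (hbM j) (Or.inr hij) (Or.inr rfl))
  · simp only [Finset.mem_image, Finset.mem_univ, true_and]
    rintro _ ⟨i, rfl⟩; exact ⟨hbM i, hbZ i⟩
  · simp only [Finset.mem_image, Finset.mem_univ, true_and]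
    rintro _ ⟨i, rfl⟩; exact ⟨hwZ i, hwM i⟩
  · simp only [Finset.mem_image, Finset.mem_univ, true_and]
    exact ⟨0, by simp [b, x]⟩

/-- A cycle of `M △ Z` through a vertex contains the edges of both dimers at this vertex. -/
theorem edgeAt_mem_of_mem_cycles [Fintype E] {M Z : G.Dimer} {C : Finset E × Finset E}
    (hC : C ∈ cycles M Z) {e : E} (he : e ∈ C.1 ∨ e ∈ C.2) {v : V}
    (hv : G.black e = v ∨ G.white e = v) : M.edgeAt v ∈ C.1 ∧ Z.edgeAt v ∈ C.2 := by
  obtain ⟨⟨n, hn, b, w, h1, h2, -, -, -, h6, h7⟩, hP, hN⟩ := mem_cycles.1 hC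
  have hb : ∀ i, b i ∈ C.1 := fun i => (h6 _).2 ⟨i, rfl⟩
  have hw : ∀ i, w i ∈ C.2 := fun i => (h7 _).2 ⟨i, rfl⟩
  have key : ∀ i j, (G.black (b i) = v ∨ G.white (b i) = v) →
      (G.black (w j) = v ∨ G.white (w j) = v) → M.edgeAt v ∈ C.1 ∧ Z.edgeAt v ∈ C.2 :=
    fun i j hi hj => ⟨M.eq_edgeAt (hP _ (hb i)).1 hi ▸ hb i, Z.eq_edgeAt (hN _ (hw j)).1 hj ▸ hw j⟩
  rcases he with he | he
  · obtain ⟨i, rfl⟩ := (h6 _).1 he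
    rcases hv with hv | hv
    · exact key i (i - 1) (Or.inl hv) (Or.inl (by rw [h2, sub_add_cancel, hv]))
    · exact key i i (Or.inr hv) (Or.inr (by rw [← h1, hv]))
  · obtain ⟨i, rfl⟩ := (h7 _).1 he
    rcases hv with hv | hv
    · exact key (i + 1) i (Or.inl (by rw [← h2, hv])) (Or.inl hv)
    · exact key i i (Or.inr (by rw [h1, hv])) (Or.inr hv)

/-- The cycles of `M △ Z` are the orbits of `nextEdge M Z`. -/
theorem mem_left_iff_of_mem_cycles [Fintype E] {M Z : G.Dimer} {C : Finset E × Finset E}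
    (hC : C ∈ cycles M Z) (x : M.edges) (hx : x.1 ∈ C.1) (e : E) :
    e ∈ C.1 ↔ ∃ k : ℕ, ((nextEdge M Z)^[k] x).1 = e := by
  obtain ⟨⟨n, hn, b, w, h1, h2, -, -, -, h6, h7⟩, hP, hN⟩ := mem_cycles.1 hC
  have : NeZero n := ⟨hn.ne'⟩
  have hb : ∀ i, b i ∈ C.1 := fun i => (h6 _).2 ⟨i, rfl⟩
  have hw : ∀ i, w i ∈ C.2 := fun i => (h7 _).2 ⟨i, rfl⟩
  obtain ⟨j, hj⟩ := (h6 _).1 hx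
  have hk : ∀ k : ℕ, ((nextEdge M Z)^[k] x).1 = b (j + k) := by
    intro k
    induction k with
    | zero => simp [hj]
    | succ k ih =>
      rw [Function.iterate_succ_apply']
      change M.edgeAt (G.black (Z.edgeAt (G.white ((nextEdge M Z)^[k] x).1))) = _
      rw [ih, ← Z.eq_edgeAt (hN _ (hw (j + k))).1 (Or.inr (h1 _).symm),
        ← M.eq_edgeAt (hP _ (hb (j + k + 1))).1 (Or.inl (h2 _).symm)]
      push_cast
      rw [add_assoc]
  constructor
  · intro he
    obtain ⟨i, rfl⟩ := (h6 _).1 he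
    exact ⟨(i - j).val, by rw [hk]; simp⟩
  · rintro ⟨k, rfl⟩
    rw [hk]; exact hb _

theorem mem_right_iff_of_mem_cycles [Fintype E] {M Z : G.Dimer} {C : Finset E × Finset E}
    (hC : C ∈ cycles M Z) (e : E) :
    e ∈ C.2 ↔ ∃ e' ∈ C.1, Z.edgeAt (G.white e') = e := by
  constructor
  · intro he
    refine ⟨_, (edgeAt_mem_of_mem_cycles hC (Or.inr he) (Or.inr rfl)).1, ?_⟩
    rw [M.white_edgeAt (G.not_isBlack_white _)]
    exact (Z.eq_edgeAt ((mem_cycles.1 hC).2.2 e he).1 (Or.inr rfl)).symm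
  · rintro ⟨e', he', rfl⟩
    exact (edgeAt_mem_of_mem_cycles hC (Or.inl he') (Or.inr rfl)).2

theorem eq_of_mem_cycles [Fintype E] {M Z : G.Dimer} {C C' : Finset E × Finset E}
    (hC : C ∈ cycles M Z) (hC' : C' ∈ cycles M Z) {e : E} (he : e ∈ C.1) (he' : e ∈ C'.1) :
    C = C' := by
  have heM := ((mem_cycles.1 hC).2.1 e he).1
  have h1 : C.1 = C'.1 := by
    ext a
    rw [mem_left_iff_of_mem_cycles hC ⟨e, heM⟩ he, mem_left_iff_of_mem_cycles hC' ⟨e, heM⟩ he']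
  refine Prod.ext h1 ?_
  ext a
  rw [mem_right_iff_of_mem_cycles hC, mem_right_iff_of_mem_cycles hC', h1]

/-- The cycles of `M △ Z` decompose the flow `M - Z`. -/
theorem dimerFlow_eq_sum_cycles [Fintype E] (M Z : G.Dimer) :
    dimerFlow M Z = ∑ C ∈ cycles M Z, (edgeIndicator C.1 - edgeIndicator C.2) := by
  classical
  ext e
  rw [Finset.sum_apply]
  simp only [dimerFlow, Pi.sub_apply]
  by_cases heM : e ∈ M.edges <;> by_cases heZ : e ∈ Z.edges
  · rw [edgeIndicator_of_mem heM, edgeIndicator_of_mem heZ, Finset.sum_eq_zero, sub_self]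
    intro C hC
    rw [edgeIndicator_of_notMem fun h => ((mem_cycles.1 hC).2.1 e h).2 heZ,
      edgeIndicator_of_notMem fun h => ((mem_cycles.1 hC).2.2 e h).2 heM, sub_self]
  · obtain ⟨C₀, hC₀, he⟩ := exists_mem_cycles heM heZ
    rw [edgeIndicator_of_mem heM, edgeIndicator_of_notMem heZ, Finset.sum_eq_single_of_mem C₀ hC₀,
      edgeIndicator_of_mem he, edgeIndicator_of_notMem fun h => heZ ((mem_cycles.1 hC₀).2.2 e h).1]
    intro C hC hne
    rw [edgeIndicator_of_notMem fun h => hne (eq_of_mem_cycles hC hC₀ h he),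
      edgeIndicator_of_notMem fun h => heZ ((mem_cycles.1 hC).2.2 e h).1, sub_self]
  · -- the edge `e` of `Z` is in the cycle through the edge of `M` at its white end
    set e' := M.edgeAt (G.white e)
    have he'M : e' ∈ M.edges := M.edgeAt_mem _
    have he'w : G.white e' = G.white e := M.white_edgeAt (G.not_isBlack_white _)
    have he'Z : e' ∉ Z.edges := fun h =>
      heM (Z.eq_of_mem h heZ (Or.inr he'w) (Or.inr rfl) ▸ he'M)
    obtain ⟨C₀, hC₀, he⟩ := exists_mem_cycles he'M he'Z
    have heC : ∀ C ∈ cycles M Z, e ∈ C.2 → e' ∈ C.1 := fun C hC h =>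
      (edgeAt_mem_of_mem_cycles hC (Or.inr h) (Or.inr rfl)).1
    have heC₀ : e ∈ C₀.2 := (mem_right_iff_of_mem_cycles hC₀ e).2 ⟨e', he, by
      rw [he'w]; exact (Z.eq_edgeAt heZ (Or.inr rfl)).symm⟩
    rw [edgeIndicator_of_notMem heM, edgeIndicator_of_mem heZ, Finset.sum_eq_single_of_mem C₀ hC₀,
      edgeIndicator_of_mem heC₀,
      edgeIndicator_of_notMem fun h => heM ((mem_cycles.1 hC₀).2.1 e h).1]
    intro C hC hne
    rw [edgeIndicator_of_notMem fun h => heM ((mem_cycles.1 hC).2.1 e h).1,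
      edgeIndicator_of_notMem fun h => hne (eq_of_mem_cycles hC hC₀ (heC C hC h) he), sub_self]
  · rw [edgeIndicator_of_notMem heM, edgeIndicator_of_notMem heZ, Finset.sum_eq_zero, sub_self]
    intro C hC
    rw [edgeIndicator_of_notMem fun h => heM ((mem_cycles.1 hC).2.1 e h).1,
      edgeIndicator_of_notMem fun h => heZ ((mem_cycles.1 hC).2.2 e h).1, sub_self]

theorem heightAt_eq [Fintype E] [Nonempty G.Dimer] (M : G.Dimer) {p : ℂ} (hp : p ∉ G.drawing) :
    (heightAt M p : ℚ) = -G.winding (dimerFlow M G.zeroHat) p := by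
  have hsum : ∀ s : Finset (Finset E × Finset E),
      G.winding (∑ C ∈ s, (edgeIndicator C.1 - edgeIndicator C.2)) p =
        ∑ C ∈ s, G.winding (edgeIndicator C.1 - edgeIndicator C.2) p := fun s => by
    classical
    induction s using Finset.induction_on with
    | empty => simp [winding]
    | insert C s hC ih => rw [Finset.sum_insert hC, Finset.sum_insert hC, winding_add, ih]
  rw [dimerFlow_eq_sum_cycles, hsum, heightAt, Finset.sum_neg_distrib, Int.cast_neg, Int.cast_sum]
  congr 1
  exact Finset.sum_congr rfl fun C hC => (mem_cycles.1 hC).1.wind_eq hp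

/-! ### Heights and flips -/

/-- A flow that is supported on a directed cycle is a multiple of it. -/
theorem IsDirectedCycle.exists_eq_smul [Fintype E] {P N : Finset E} (h : G.IsDirectedCycle P N)
    {z : E → ℚ} (hz : z ∈ G.flows) (hsupp : ∀ e, e ∉ P → e ∉ N → z e = 0) :
    ∃ c : ℚ, z = c • (edgeIndicator P - edgeIndicator N) := by
  classical
  obtain ⟨n, hn, b, w, h1, h2, h3, h4, h5, h6, h7⟩ := h
  have : NeZero n := ⟨hn.ne'⟩
  have hbw : ∀ i j, b i ≠ w j := fun i j hij => by
    have : i = j := h4 (by simp only [h1 j, hij])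
    exact h5 i (by rw [hij, this])
  obtain ⟨hzb, hzw⟩ := mem_flows.1 hz
  have hcases : ∀ e, z e ≠ 0 → (∃ i, b i = e) ∨ ∃ i, w i = e := fun e he => by
    by_contra! hcon
    exact he (hsupp e (fun h => hcon.1 _ ((h6 e).1 h).choose_spec)
      fun h => hcon.2 _ ((h7 e).1 h).choose_spec)
  have e1 : ∀ i, z (b i) + z (w i) = 0 := fun i => by
    have := hzw (G.white (b i))
    rw [Fintype.sum_eq_add (b i) (w i) (h5 i), if_pos rfl, if_pos (h1 i).symm] at this
    · exact this
    · rintro e ⟨he1, he2⟩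
      split_ifs with hv
      · by_contra hne
        rcases hcases e hne with ⟨j, rfl⟩ | ⟨j, rfl⟩
        · exact he1 (congrArg b (h4 hv))
        · exact he2 (congrArg w (h4 ((h1 j).trans hv)))
      · rfl
  have e2 : ∀ i, z (w i) + z (b (i + 1)) = 0 := fun i => by
    have := hzb (G.black (w i))
    rw [Fintype.sum_eq_add (w i) (b (i + 1)) (hbw _ _).symm, if_pos rfl, if_pos (h2 i).symm] at this
    · exact this
    · rintro e ⟨he1, he2⟩
      split_ifs with hv
      · by_contra hne
        rcases hcases e hne with ⟨j, rfl⟩ | ⟨j, rfl⟩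
        · exact he2 (congrArg b (h3 (hv.trans (h2 i))))
        · refine he1 (congrArg w ?_)
          exact add_right_cancel (h3 ((h2 j).symm.trans (hv.trans (h2 i))))
      · rfl
  have e3 : ∀ k : ℕ, z (b k) = z (b 0) := fun k => by
    induction k with
    | zero => simp
    | succ k ih =>
      push_cast
      rw [← ih]
      linarith [e1 k, e2 k]
  have e4 : ∀ i, z (b i) = z (b 0) := fun i => by
    rw [← e3 i.val, ZMod.natCast_zmod_val]
  refine ⟨z (b 0), ?_⟩
  ext e
  simp only [Pi.smul_apply, Pi.sub_apply, smul_eq_mul]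
  by_cases heP : e ∈ P
  · obtain ⟨i, rfl⟩ := (h6 e).1 heP
    rw [edgeIndicator_of_mem heP, edgeIndicator_of_notMem, e4]
    · ring
    · intro hN
      obtain ⟨j, hj⟩ := (h7 _).1 hN
      exact hbw _ _ hj.symm
  · by_cases heN : e ∈ N
    · obtain ⟨i, rfl⟩ := (h7 e).1 heN
      rw [edgeIndicator_of_mem heN, edgeIndicator_of_notMem heP]
      linarith [e1 i, e4 i]
    · rw [edgeIndicator_of_notMem heN, edgeIndicator_of_notMem heP, hsupp e heP heN]; simp

namespace IsBridgeless

variable [Fintype V] [Fintype E] (h : G.IsBridgeless)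

/-- The clockwise boundary cycle of a face is the negative of the boundary flow. -/
theorem edgeIndicator_sub_eq_neg_faceFlow {f : G.Face} {P N : Finset E}
    (hf : f.IsClockwiseBoundary P N) : edgeIndicator P - edgeIndicator N = -h.faceFlow f := by
  classical
  obtain ⟨hc, hfr, hwind⟩ := hf
  obtain ⟨c, hcz⟩ := hc.exists_eq_smul (h.faceFlow_mem f) fun e heP heN => by
    by_contra hne
    have hside : h.left e ∈ f.1 ∨ h.right e ∈ f.1 := by
      by_contra! hcon
      exact hne (by rw [h.faceFlow_apply, if_neg hcon.1, if_neg hcon.2, sub_self])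
    have hmid : G.arc e midParam ∈ frontier f.1 :=
      h.range_arc_subset_frontier hside ⟨_, rfl⟩
    have h0 : midParam ≠ 0 := fun h => by
      have := congrArg Subtype.val h; norm_num [midParam] at this
    have h1 : midParam ≠ 1 := fun h => by
      have := congrArg Subtype.val h; norm_num [midParam] at this
    rw [hfr] at hmid
    simp only [mem_union, mem_iUnion] at hmid
    rcases hmid with ⟨e', he', hm⟩ | ⟨e', he', hm⟩
    · exact arc_notMem_range_of_ne (fun hee : e' = e => heP (hee ▸ he')) h0 h1 hm
    · exact arc_notMem_range_of_ne (fun hee : e' = e => heN (hee ▸ he')) h0 h1 hm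
  have h1 := h.winding_faceFlow_of_mem f.point_mem
  have h2 := hc.wind_eq (f.notMem_drawing f.point_mem)
  rw [hwind _ f.point_mem] at h2
  rw [hcz, winding_smul, ← h2] at h1
  have hc1 : c = -1 := by push_cast at h1; linarith
  rw [hcz, hc1]; simp

theorem dimerFlow_eq_faceFlow {f : G.Face} {M M' : G.Dimer} (hf : DownFlip f M M') :
    dimerFlow M' M = h.faceFlow f := by
  classical
  obtain ⟨P, N, hb, hPM, hM'⟩ := hf
  have h1 := h.edgeIndicator_sub_eq_neg_faceFlow hb
  have hPN : ∀ e ∈ N, e ∉ M.edges := by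
    obtain ⟨n, -, b, w, hbw, -, -, -, hne, hP, hN⟩ := hb.1
    intro e he heM
    obtain ⟨i, rfl⟩ := (hN e).1 he
    have hbM := hPM ((hP (b i)).2 ⟨i, rfl⟩)
    exact hne i (M.eq_of_mem hbM heM (Or.inr (hbw i)) (Or.inr rfl))
  rw [← neg_neg (h.faceFlow f), ← h1, neg_sub]
  ext e
  simp only [dimerFlow, Pi.sub_apply]
  have hmem : e ∈ M'.edges ↔ (e ∈ M.edges ∧ e ∉ P) ∨ e ∈ N := by
    rw [hM', Finset.mem_union, Finset.mem_sdiff]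
  have hP' := @hPM e
  have hN' := hPN e
  by_cases h2 : e ∈ P <;> by_cases h3 : e ∈ N <;> by_cases h4 : e ∈ M.edges <;>
    simp_all [edgeIndicator]

theorem _root_.BipartitePlaneGraph.existsUnique_of_sum_eq_one {S : Finset E} {p : E → Prop}
    [DecidablePred p] (hs : ∑ e, (if p e then edgeIndicator S e else 0) = 1) :
    ∃! e, e ∈ S ∧ p e := by
  classical
  have h1 : ∑ e, (if p e then edgeIndicator S e else 0) =
      ((Finset.univ.filter fun e => e ∈ S ∧ p e).card : ℚ) := by
    rw [Finset.card_filter]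
    push_cast
    refine Finset.sum_congr rfl fun e _ => ?_
    by_cases h1 : p e <;> by_cases h2 : e ∈ S <;> simp [h1, h2, edgeIndicator]
  rw [h1] at hs
  obtain ⟨a, ha⟩ := Finset.card_eq_one.1 (by exact_mod_cast hs)
  refine ⟨a, ?_, fun e he => ?_⟩
  · have : a ∈ Finset.univ.filter fun e => e ∈ S ∧ p e := by rw [ha]; simp
    exact (Finset.mem_filter.1 this).2
  · have : e ∈ Finset.univ.filter fun e => e ∈ S ∧ p e :=
      Finset.mem_filter.2 ⟨Finset.mem_univ _, he⟩
    rw [ha] at this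
    exact Finset.mem_singleton.1 this

/-- If a dimer contains all edges with the face `f` on their right and none of those with `f` on their
left, then it has a down-flip at `f`. The two sets of edges form a union of cycles, and there is
only one as the frontier of `f` is connected. -/
theorem exists_downFlip {M : G.Dimer} {f : G.Face} (hr : ∀ e, h.right e ∈ f.1 → e ∈ M.edges)
    (hl : ∀ e, h.left e ∈ f.1 → e ∉ M.edges) : ∃ M', DownFlip f M M' := by
  classical
  set P : Finset E := Finset.univ.filter fun e => h.right e ∈ f.1
  set N : Finset E := Finset.univ.filter fun e => h.left e ∈ f.1
  have hP : ∀ e, e ∈ P ↔ h.right e ∈ f.1 := fun e => by simp [P]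
  have hN : ∀ e, e ∈ N ↔ h.left e ∈ f.1 := fun e => by simp [N]
  have hflow : h.faceFlow f = edgeIndicator N - edgeIndicator P := by
    ext e
    rw [h.faceFlow_apply, Pi.sub_apply, edgeIndicator, edgeIndicator]
    simp only [hP, hN]
  have hPM : P ⊆ M.edges := fun e he => hr e ((hP e).1 he)
  have hNM : ∀ e ∈ N, e ∉ M.edges := fun e he => hl e ((hN e).1 he)
  set S := (M.edges \ P) ∪ N with hS
  have hSmem : ∀ e, e ∈ S ↔ (e ∈ M.edges ∧ e ∉ P) ∨ e ∈ N := fun e => by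
    rw [hS, Finset.mem_union, Finset.mem_sdiff]
  have hSM : edgeIndicator S - edgeIndicator M.edges = h.faceFlow f := by
    rw [hflow]
    ext e
    have hP' := @hPM e
    have hN' := hNM e
    simp only [Pi.sub_apply, edgeIndicator, hSmem]
    by_cases h2 : e ∈ P <;> by_cases h3 : e ∈ N <;> by_cases h4 : e ∈ M.edges <;> simp_all
  obtain ⟨hfb, hfw⟩ := mem_flows.1 (h.faceFlow_mem f)
  have hperf : ∀ v, ∃! e, e ∈ S ∧ (G.black e = v ∨ G.white e = v) := by
    intro v
    by_cases hv : G.IsBlack v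
    · have h1 := hfb v
      rw [← hSM, sum_ite_sub, M.sum_black, if_pos hv, sub_eq_zero] at h1
      obtain ⟨e, he, huniq⟩ := existsUnique_of_sum_eq_one h1
      refine ⟨e, ⟨he.1, Or.inl he.2⟩, fun e' he' => huniq e' ⟨he'.1, he'.2.resolve_right ?_⟩⟩
      exact fun hw => G.not_isBlack_white e' (hw ▸ hv)
    · have h1 := hfw v
      rw [← hSM, sum_ite_sub, M.sum_white, if_neg hv, sub_eq_zero] at h1
      obtain ⟨e, he, huniq⟩ := existsUnique_of_sum_eq_one h1
      refine ⟨e, ⟨he.1, Or.inr he.2⟩, fun e' he' => huniq e' ⟨he'.1, he'.2.resolve_left ?_⟩⟩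
      exact fun hw => hv (hw ▸ G.isBlack_black e')
  set M' : G.Dimer := ⟨S, hperf⟩
  have hM'mem : ∀ e, e ∈ M'.edges ↔ (e ∈ M.edges ∧ e ∉ P) ∨ e ∈ N := hSmem
  have hdiff : ∀ e, e ∈ P ↔ e ∈ M.edges ∧ e ∉ M'.edges := fun e => by
    rw [hM'mem]
    have hP' := @hPM e
    have hN' := hNM e
    tauto
  have hdiff' : ∀ e, e ∈ N ↔ e ∈ M'.edges ∧ e ∉ M.edges := fun e => by
    rw [hM'mem]
    have hN' := hNM e
    tauto
  -- a cycle of `M △ M'`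
  have hPne : P.Nonempty := by
    obtain ⟨e, he | he⟩ := h.exists_side_mem f
    · have heN := (hN e).2 he
      refine ⟨M.edgeAt (G.black e), (hdiff _).2 ⟨M.edgeAt_mem _, fun hm => ?_⟩⟩
      have : M.edgeAt (G.black e) = e := M'.eq_of_mem hm ((hdiff' e).1 heN).1
        (Or.inl (M.black_edgeAt (G.isBlack_black e))) (Or.inl rfl)
      exact hNM e heN (this ▸ M.edgeAt_mem _)
    · exact ⟨e, (hP e).2 he⟩
  obtain ⟨e₀, he₀⟩ := hPne
  obtain ⟨C, hC, heC⟩ := exists_mem_cycles ((hdiff e₀).1 he₀).1 ((hdiff e₀).1 he₀).2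
  obtain ⟨hCc, hC1, hC2⟩ := mem_cycles.1 hC
  have hC1P : ∀ e ∈ C.1, e ∈ P := fun e he => (hdiff e).2 (hC1 e he)
  have hC2N : ∀ e ∈ C.2, e ∈ N := fun e he => (hdiff' e).2 (hC2 e he)
  -- it contains all edges of the frontier
  have hfrontier : frontier f.1 = ⋃ e ∈ {e | e ∈ N ∨ e ∈ P}, range (G.arc e) := by
    rw [h.frontier_eq]; simp only [hP, hN]
  have hall : ∀ e, e ∈ N ∨ e ∈ P → e ∈ C.1 ∨ e ∈ C.2 := by
    by_contra! hcon
    obtain ⟨e₁, he₁, he₁C⟩ := hcon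
    have hcl : ∀ T : Set E, IsClosed (⋃ e ∈ T, range (G.arc e)) := fun T =>
      (toFinite T).isClosed_biUnion fun e' _ => (isCompact_range (G.arc e').continuous).isClosed
    have hpre := h.isPreconnected_frontier f
    rw [hfrontier] at hpre
    obtain ⟨y, -, hy1, hy2⟩ := isPreconnected_closed_iff.1 hpre
      (⋃ e ∈ {e | e ∈ C.1 ∨ e ∈ C.2}, range (G.arc e))
      (⋃ e ∈ {e | (e ∈ N ∨ e ∈ P) ∧ ¬ (e ∈ C.1 ∨ e ∈ C.2)}, range (G.arc e)) (hcl _) (hcl _)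
      (by
        refine iUnion₂_subset fun e he => ?_
        by_cases heC : e ∈ C.1 ∨ e ∈ C.2
        · exact subset_union_of_subset_left (subset_biUnion_of_mem (u := fun e => range (G.arc e))
            (show e ∈ {e | e ∈ C.1 ∨ e ∈ C.2} from heC)) _
        · exact subset_union_of_subset_right (subset_biUnion_of_mem (u := fun e => range (G.arc e))
            (show e ∈ {e | (e ∈ N ∨ e ∈ P) ∧ ¬ (e ∈ C.1 ∨ e ∈ C.2)} from ⟨he, heC⟩)) _)
      ⟨G.arc e₀ 0, mem_biUnion (show e₀ ∈ {e | e ∈ N ∨ e ∈ P} from Or.inr he₀) ⟨0, rfl⟩,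
        mem_biUnion (show e₀ ∈ {e | e ∈ C.1 ∨ e ∈ C.2} from Or.inl heC) ⟨0, rfl⟩⟩
      ⟨G.arc e₁ 0, mem_biUnion (show e₁ ∈ {e | e ∈ N ∨ e ∈ P} from he₁) ⟨0, rfl⟩,
        mem_biUnion (show e₁ ∈ {e | (e ∈ N ∨ e ∈ P) ∧ ¬ (e ∈ C.1 ∨ e ∈ C.2)} from
          ⟨he₁, fun h => h.elim he₁C.1 he₁C.2⟩) ⟨0, rfl⟩⟩
    simp only [mem_iUnion] at hy1 hy2
    obtain ⟨a, ha, s, hs⟩ := hy1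
    obtain ⟨a', ha', t, ht⟩ := hy2
    have hne : a ≠ a' := fun haa => ha'.2 (haa ▸ ha)
    have hst : G.arc a s = G.arc a' t := hs.trans ht.symm
    -- the two edges share a vertex
    have hend : ∀ (e : E) (t : unitInterval), t = 0 ∨ t = 1 →
        ∃ v, G.arc e t = G.pos v ∧ (G.black e = v ∨ G.white e = v) := by
      rintro e t (rfl | rfl)
      · exact ⟨_, Path.source _, Or.inl rfl⟩
      · exact ⟨_, Path.target _, Or.inr rfl⟩
    obtain ⟨v, hv, hav⟩ := hend a s (G.arc_eq_arc a a' s t hne hst)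
    obtain ⟨v', hv', hav'⟩ := hend a' t (G.arc_eq_arc a' a t s hne.symm hst.symm)
    have hvv : v' = v := G.pos_injective (by rw [← hv, ← hv', hst])
    rw [hvv] at hav'
    obtain ⟨hm1, hm2⟩ := edgeAt_mem_of_mem_cycles hC ha hav
    rcases ha'.1 with haN | haP
    · rw [← M'.eq_edgeAt ((hdiff' a').1 haN).1 hav'] at hm2
      exact ha'.2 (Or.inr hm2)
    · rw [← M.eq_edgeAt ((hdiff a').1 haP).1 hav'] at hm1
      exact ha'.2 (Or.inl hm1)
  have hCP : C.1 = P := by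
    ext e
    refine ⟨hC1P e, fun he => (hall e (Or.inr he)).resolve_right fun h2 => ?_⟩
    exact hNM e (hC2N e h2) (hPM he)
  have hCN : C.2 = N := by
    ext e
    refine ⟨hC2N e, fun he => (hall e (Or.inl he)).resolve_left fun h1 => ?_⟩
    exact hNM e he (hPM (hC1P e h1))
  rw [hCP, hCN] at hCc
  refine ⟨M', P, N, ⟨hCc, ?_, fun p hp => ?_⟩, hPM, ?_⟩
  · rw [hfrontier]
    ext x
    simp only [mem_iUnion, mem_union, mem_ofPred_eq, exists_prop]
    constructor
    · rintro ⟨e, he | he, hx⟩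
      exacts [Or.inr ⟨e, he, hx⟩, Or.inl ⟨e, he, hx⟩]
    · rintro (⟨e, he, hx⟩ | ⟨e, he, hx⟩)
      exacts [⟨e, Or.inr he, hx⟩, ⟨e, Or.inl he, hx⟩]
  · have h1 := hCc.wind_eq (f.notMem_drawing hp)
    rw [← neg_sub, ← hflow, winding_neg, h.winding_faceFlow_of_mem hp] at h1
    exact_mod_cast h1
  · ext e
    simp only [hM'mem, Finset.mem_union, Finset.mem_sdiff]

end IsBridgeless

/-- The height of the dimer `M` relative to the dimer `N` at a point. -/
noncomputable def relHeight [Fintype E] (M N : G.Dimer) (p : ℂ) : ℚ :=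
  -G.winding (dimerFlow M N) p

theorem relHeight_add [Fintype E] (M N L : G.Dimer) (p : ℂ) :
    relHeight M N p + relHeight N L p = relHeight M L p := by
  rw [relHeight, relHeight, relHeight, ← dimerFlow_add M N L, winding_add]; ring

theorem neg_relHeight [Fintype E] (M N : G.Dimer) (p : ℂ) :
    -relHeight M N p = relHeight N M p := by
  rw [relHeight, relHeight, ← neg_dimerFlow N M, winding_neg, neg_neg]

theorem relHeight_eq_of_mem [Fintype E] (M N : G.Dimer) (f : G.Face) {p q : ℂ} (hp : p ∈ f.1)
    (hq : q ∈ f.1) : relHeight M N p = relHeight M N q := by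
  rw [relHeight, relHeight, f.winding_eq (dimerFlow_mem M N) hp hq]

namespace IsBridgeless

variable [Fintype V] [Fintype E] (h : G.IsBridgeless)

theorem relHeight_left (M N : G.Dimer) (e : E) :
    relHeight M N (h.left e) = relHeight M N (h.right e) - dimerFlow M N e := by
  rw [relHeight, relHeight, ← h.winding_left_sub_right e (dimerFlow_mem M N)]; ring

open Classical in
theorem relHeight_of_downFlip (h : G.IsBridgeless) {f : G.Face} {M M' : G.Dimer} (hf : DownFlip f M M')
    (g : G.Face) : relHeight M M' g.point = if g = f then 1 else 0 := by
  rw [← neg_relHeight, relHeight, neg_neg, h.dimerFlow_eq_faceFlow hf]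
  split_ifs with hg
  · rw [hg]; exact h.winding_faceFlow_of_mem f.point_mem
  · exact h.winding_faceFlow_of_notMem (fun hm => hg (Face.eq_of_mem g.point_mem hm))
      (g.notMem_drawing g.point_mem)

theorem eq_of_relHeight_eq_zero (h : G.IsBridgeless) {M N : G.Dimer}
    (h0 : ∀ f : G.Face, relHeight M N f.point = 0) : M = N := by
  have h1 : ∀ p, p ∉ G.drawing → relHeight M N p = 0 := by
    intro p hp
    rcases exists_face_or_winding_eq_zero hp with ⟨f, hf⟩ | hz
    · rw [relHeight_eq_of_mem M N f hf f.point_mem, h0]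
    · rw [relHeight, hz _ (dimerFlow_mem M N), neg_zero]
  refine eq_of_dimerFlow_eq_zero (funext fun e => ?_)
  have := h.relHeight_left M N e
  rw [h1 _ (h.left_notMem_drawing e), h1 _ (h.right_notMem_drawing e)] at this
  simp at this; exact this

/-- A dimer that is higher than another one at some face has a down-flip at such a face: among the
faces with positive relative height, one that minimizes the sum of the heights of all dimers
relative to `M` is suitable. Otherwise this sum decreases strictly from it to a neighbouring face of
at least the same relative height. -/
theorem exists_downFlip_of_relHeight_pos (h : G.IsBridgeless) (hmem : ∀ e, ∃ N : G.Dimer, e ∈ N.edges)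
    (hnot : ∀ e, ∃ N : G.Dimer, e ∉ N.edges) {M Z : G.Dimer} {f₀ : G.Face}
    (hf₀ : 0 < relHeight M Z f₀.point) :
    ∃ f : G.Face, 0 < relHeight M Z f.point ∧ ∃ M', DownFlip f M M' := by
  classical
  have := h.finite_face
  set Φ : ℂ → ℚ := fun p => ∑ N : G.Dimer, relHeight N M p with hΦ
  obtain ⟨f, hf, hmin⟩ := (toFinite {f : G.Face | 0 < relHeight M Z f.point}).exists_minimalFor
    (fun f => Φ f.point) _ ⟨f₀, hf₀⟩
  have hf' : 0 < relHeight M Z f.point := hf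
  -- no neighbouring point has at least the same relative height and a smaller sum of heights
  have key : ∀ p q, p ∈ f.1 → q ∉ G.drawing → relHeight M Z p ≤ relHeight M Z q →
      Φ q < Φ p → False := by
    intro p q hp hq h1 h2
    rw [relHeight_eq_of_mem M Z f hp f.point_mem] at h1
    rcases exists_face_or_winding_eq_zero hq with ⟨g, hg⟩ | hz
    · have hΦf : ∀ (f : G.Face) p, p ∈ f.1 → Φ f.point = Φ p := fun f p hp =>
        Finset.sum_congr rfl fun N _ => relHeight_eq_of_mem N M f f.point_mem hp
      have hgpos : 0 < relHeight M Z g.point := by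
        rw [relHeight_eq_of_mem M Z g g.point_mem hg]; linarith
      have h3 : Φ g.point ≤ Φ f.point := by
        rw [hΦf g q hg, hΦf f p hp]; exact h2.le
      have h4 := hmin hgpos h3
      simp only at h4
      rw [hΦf g q hg, hΦf f p hp] at h4
      exact h4.not_gt h2
    · rw [relHeight.eq_def M Z q, hz _ (dimerFlow_mem M Z)] at h1
      linarith
  refine ⟨f, hf', h.exists_downFlip (fun e he => ?_) (fun e he heM => ?_)⟩
  · by_contra heM
    refine key (h.right e) (h.left e) he (h.left_notMem_drawing e) ?_ ?_
    · rw [h.relHeight_left, dimerFlow, Pi.sub_apply, edgeIndicator_of_notMem heM]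
      linarith [edgeIndicator_nonneg Z.edges e]
    · obtain ⟨N, hN⟩ := hmem e
      refine Finset.sum_lt_sum (fun L _ => ?_) ⟨N, Finset.mem_univ N, ?_⟩
      · rw [h.relHeight_left, dimerFlow, Pi.sub_apply, edgeIndicator_of_notMem heM]
        linarith [edgeIndicator_nonneg L.edges e]
      · rw [h.relHeight_left, dimerFlow, Pi.sub_apply, edgeIndicator_of_notMem heM,
          edgeIndicator_of_mem hN]
        linarith
  · refine key (h.left e) (h.right e) he (h.right_notMem_drawing e) ?_ ?_
    · rw [h.relHeight_left, dimerFlow, Pi.sub_apply, edgeIndicator_of_mem heM]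
      linarith [edgeIndicator_le_one Z.edges e]
    · obtain ⟨N, hN⟩ := hnot e
      refine Finset.sum_lt_sum (fun L _ => ?_) ⟨N, Finset.mem_univ N, ?_⟩
      · rw [h.relHeight_left, dimerFlow, Pi.sub_apply, edgeIndicator_of_mem heM]
        linarith [edgeIndicator_le_one L.edges e]
      · rw [h.relHeight_left, dimerFlow, Pi.sub_apply, edgeIndicator_of_mem heM,
          edgeIndicator_of_notMem hN]
        linarith

end IsBridgeless

/-! ### Ranks and saturated chains -/

/-- The sum of the relative heights of `M` and `N` at all faces: the difference of their ranks. -/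
noncomputable def relRank [Fintype E] (M N : G.Dimer) : ℚ :=
  ∑ᶠ f : G.Face, relHeight M N f.point

theorem le_of_downFlip {f : G.Face} {M M' : G.Dimer} (hf : DownFlip f M M') : M' ≤ M :=
  Relation.ReflTransGen.single ⟨f, hf⟩

namespace IsBridgeless

variable [Fintype V] [Fintype E]

theorem relRank_add (h : G.IsBridgeless) (M N L : G.Dimer) :
    relRank M N + relRank N L = relRank M L := by
  have := h.finite_face
  rw [relRank, relRank, ← finsum_add_distrib (toFinite _) (toFinite _)]
  exact finsum_congr fun f => relHeight_add M N L f.point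

theorem relRank_self (h : G.IsBridgeless) (M : G.Dimer) : relRank M M = 0 := by
  have := h.relRank_add M M M; linarith

theorem relRank_of_downFlip (h : G.IsBridgeless) {f : G.Face} {M M' : G.Dimer}
    (hf : DownFlip f M M') : relRank M M' = 1 := by
  classical
  rw [relRank, finsum_eq_single _ f fun g hg => by rw [h.relHeight_of_downFlip hf, if_neg hg],
    h.relHeight_of_downFlip hf, if_pos rfl]

theorem eq_or_one_le_relRank (h : G.IsBridgeless) {A B : G.Dimer} (hAB : A ≤ B) :
    A = B ∨ 1 ≤ relRank B A := by
  have hAB' : Relation.ReflTransGen (fun A B : G.Dimer => ∃ f, DownFlip f A B) B A := hAB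
  induction hAB' with
  | refl => exact Or.inl rfl
  | @tail C D hBC hCD ih =>
    obtain ⟨f, hf⟩ := hCD
    right
    rw [← h.relRank_add B C D, h.relRank_of_downFlip hf]
    rcases ih hBC with rfl | h1
    · rw [h.relRank_self]; norm_num
    · linarith

theorem covBy_of_downFlip (h : G.IsBridgeless) {f : G.Face} {M M' : G.Dimer}
    (hf : DownFlip f M M') : M' ⋖ M := by
  have h1 := h.relRank_of_downFlip hf
  have hlt : ∀ {A B : G.Dimer}, A < B → 1 ≤ relRank B A := fun {A B} hAB =>
    (h.eq_or_one_le_relRank hAB.le).resolve_left hAB.ne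
  have h2 := h.relRank_add M M' M
  rw [h.relRank_self] at h2
  refine ⟨lt_of_le_not_ge (le_of_downFlip hf) fun hle => ?_, fun C hC1 hC2 => ?_⟩
  · rcases h.eq_or_one_le_relRank hle with rfl | h3
    · rw [h.relRank_self] at h1; norm_num at h1
    · linarith
  · have := h.relRank_add M C M'
    linarith [hlt hC1, hlt hC2]

theorem relRank_pos_of_relHeight_pos (h : G.IsBridgeless) {M N : G.Dimer}
    (h0 : ∀ f : G.Face, 0 ≤ relHeight M N f.point) (hne : M ≠ N) :
    ∃ f : G.Face, 0 < relHeight M N f.point := by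
  by_contra! hcon
  exact hne (h.eq_of_relHeight_eq_zero fun f => le_antisymm (hcon f) (h0 f))

/-- There is a least dimer, and the heights relative to it are nonnegative. A dimer without down-flips
has this property. -/
theorem exists_isBot [Nonempty G.Dimer] (h : G.IsBridgeless)
    (hmem : ∀ e, ∃ N : G.Dimer, e ∈ N.edges)
    (hnot : ∀ e, ∃ N : G.Dimer, e ∉ N.edges) : ∃ Z : G.Dimer, IsBot Z ∧
      (∀ f M', ¬ DownFlip f Z M') ∧ ∀ (M : G.Dimer) (f : G.Face), 0 ≤ relHeight M Z f.point := by
  obtain ⟨M₀⟩ := ‹Nonempty G.Dimer›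
  obtain ⟨Z, -, hZ⟩ := Finset.exists_min_image Finset.univ (fun M : G.Dimer => relRank M M₀)
    ⟨M₀, Finset.mem_univ _⟩
  have hflip : ∀ f M', ¬ DownFlip f Z M' := fun f M' hf => by
    have h1 := hZ M' (Finset.mem_univ _)
    have h2 := h.relRank_of_downFlip hf
    have h3 := h.relRank_add Z M' M₀
    linarith
  have hpos : ∀ (M : G.Dimer) (f : G.Face), 0 ≤ relHeight M Z f.point := fun M f => by
    by_contra! hcon
    have h1 : 0 < relHeight Z M f.point := by rw [← neg_relHeight]; linarith
    obtain ⟨g, -, M', hM'⟩ := h.exists_downFlip_of_relHeight_pos hmem hnot h1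
    exact hflip g M' hM'
  refine ⟨Z, ?_, hflip, hpos⟩
  by_contra hcon
  simp only [IsBot, not_forall] at hcon
  -- a dimer of minimal rank among those that are not above `Z`
  obtain ⟨M, hM, hmin⟩ := (toFinite {M : G.Dimer | ¬ Z ≤ M}).exists_minimalFor
    (fun M => relRank M Z) _ hcon
  obtain ⟨f, hf⟩ := h.relRank_pos_of_relHeight_pos (hpos M) fun hMZ => hM hMZ.ge
  obtain ⟨g, -, M', hM'⟩ := h.exists_downFlip_of_relHeight_pos hmem hnot hf
  have h1 := h.relRank_of_downFlip hM'
  have h2 := h.relRank_add M M' Z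
  by_cases hZM' : Z ≤ M'
  · exact hM (hZM'.trans (le_of_downFlip hM'))
  · have := hmin hZM' (by linarith)
    linarith

end IsBridgeless

namespace SaturatedChain

/-- The chain of length zero. -/
def refl (A : G.Dimer) : SaturatedChain A A where
  length := 0
  dimer := fun _ => A
  face := Fin.elim0
  dimer_zero := rfl
  dimer_last := rfl
  covBy := fun i => i.elim0
  flip := fun i => i.elim0

/-- A saturated chain, prolonged by one up-flip. -/
def snoc {A B M : G.Dimer} (C : SaturatedChain A B) {f : G.Face} (hf : DownFlip f M B)
    (hc : B ⋖ M) : SaturatedChain A M where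
  length := C.length + 1
  dimer := Fin.snoc (α := fun _ => G.Dimer) C.dimer M
  face := Fin.snoc (α := fun _ => G.Face) C.face f
  dimer_zero := by
    rw [← Fin.castSucc_zero, Fin.snoc_castSucc]; exact C.dimer_zero
  dimer_last := Fin.snoc_last _ _
  covBy := fun i => by
    refine Fin.lastCases ?_ (fun i => ?_) i
    · rw [Fin.snoc_castSucc, C.dimer_last, Fin.succ_last, Fin.snoc_last]; exact hc
    · rw [Fin.snoc_castSucc, Fin.succ_castSucc, Fin.snoc_castSucc]; exact C.covBy i
  flip := fun i => by
    refine Fin.lastCases ?_ (fun i => ?_) i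
    · rw [Fin.snoc_castSucc, C.dimer_last, Fin.succ_last, Fin.snoc_last, Fin.snoc_last]; exact hf
    · rw [Fin.snoc_castSucc, Fin.succ_castSucc, Fin.snoc_castSucc, Fin.snoc_castSucc]
      exact C.flip i

end SaturatedChain

theorem sum_fin_sub {A : Type*} [AddCommGroup A] (n : ℕ) (g : Fin (n + 1) → A) :
    ∑ i : Fin n, (g i.succ - g i.castSucc) = g (Fin.last n) - g 0 := by
  induction n with
  | zero => simp
  | succ n ih =>
    have h1 := ih fun i => g i.castSucc
    rw [Fin.sum_univ_castSucc]
    simp only [Fin.succ_castSucc, Fin.succ_last]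
    rw [h1]
    simp

namespace IsBridgeless

variable [Fintype V] [Fintype E]

theorem nonempty_saturatedChain (h : G.IsBridgeless) {A B : G.Dimer} (hAB : A ≤ B) :
    Nonempty (SaturatedChain A B) := by
  have hAB' : Relation.ReflTransGen (fun A B : G.Dimer => ∃ f, DownFlip f A B) B A := hAB
  induction hAB' using Relation.ReflTransGen.head_induction_on with
  | refl => exact ⟨SaturatedChain.refl A⟩
  | head hBC hCA ih =>
    obtain ⟨f, hf⟩ := hBC
    obtain ⟨C⟩ := ih hCA
    exact ⟨C.snoc hf (h.covBy_of_downFlip hf)⟩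

open Classical in
/-- The height is the number of flips at a face along a saturated chain. -/
theorem relHeight_eq_card (h : G.IsBridgeless) {A B : G.Dimer} (C : SaturatedChain A B)
    (f : G.Face) : relHeight B A f.point =
      ((Finset.univ.filter fun i => C.face i = f).card : ℚ) := by
  have h1 := sum_fin_sub C.length fun i => relHeight (C.dimer i) A f.point
  rw [C.dimer_last, C.dimer_zero] at h1
  have h2 : relHeight A A f.point = 0 := by
    have := relHeight_add A A A f.point; linarith
  rw [h2, sub_zero] at h1
  rw [← h1, Finset.card_filter]
  push_cast
  refine Finset.sum_congr rfl fun i _ => ?_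
  have h3 := relHeight_add (C.dimer i.succ) (C.dimer i.castSucc) A f.point
  rw [← h3, h.relHeight_of_downFlip (C.flip i), add_sub_cancel_right]
  simp only [eq_comm]

theorem weight_eq_monomialOf (h : G.IsBridgeless) {A B : G.Dimer} (C : SaturatedChain A B)
    {ht : G.Face → ℤ} (hht : ∀ f, (ht f : ℚ) = relHeight B A f.point) :
    C.weight = G.monomialOf ht := by
  classical
  have := h.finite_face
  have := Fintype.ofFinite G.Face
  rw [SaturatedChain.weight, monomialOf, finprod_eq_prod_of_fintype,
    ← Finset.prod_fiberwise (s := Finset.univ) (g := C.face)]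
  refine Finset.prod_congr rfl fun f _ => ?_
  have h1 : ht f = ((Finset.univ.filter fun i => C.face i = f).card : ℤ) := by
    have := hht f
    rw [h.relHeight_eq_card C] at this
    exact_mod_cast this
  rw [h1, Int.toNat_natCast, ← Finset.prod_const]
  exact Finset.prod_congr rfl fun i hi => by rw [(Finset.mem_filter.1 hi).2]

end IsBridgeless

theorem exists_edge_of_nonempty_dimer [Nonempty G.Dimer] (v : V) :
    ∃ e, G.black e = v ∨ G.white e = v := by
  obtain ⟨M⟩ := ‹Nonempty G.Dimer›
  obtain ⟨e, he, -⟩ := M.perfect v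
  exact ⟨e, he.2⟩

/-- If there are several dimers, then no edge is in all of them: such an edge would be isolated. -/
theorem PropertyStar.exists_notMem (hG : G.PropertyStar) [Nontrivial G.Dimer] (e : E) :
    ∃ N : G.Dimer, e ∉ N.edges := by
  by_contra! hcon
  have hadj : ∀ e' v, (G.black e = v ∨ G.white e = v) → (G.black e' = v ∨ G.white e' = v) →
      e' = e := fun e' v hv hv' => by
    obtain ⟨N, hN⟩ := hG.edge_mem_dimer e'
    exact N.eq_of_mem hN (hcon N) hv' hv
  have hV : ∀ v, G.black e = v ∨ G.white e = v := by
    intro v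
    have hr := (SimpleGraph.reachable_iff_reflTransGen (G.black e) v).1
      (hG.connected.preconnected _ v)
    induction hr with
    | refl => exact Or.inl rfl
    | tail _ hab ih =>
      obtain ⟨e', ⟨h1, h2⟩ | ⟨h1, h2⟩⟩ := hab
      · rw [hadj e' _ ih (Or.inl h1)] at h2; exact Or.inr h2
      · rw [hadj e' _ ih (Or.inr h2)] at h1; exact Or.inl h1
  have hall : ∀ e', e' = e := fun e' => hadj e' _ (hV (G.black e')) (Or.inl rfl)
  obtain ⟨M, N, hMN⟩ := exists_pair_ne G.Dimer
  refine hMN (Dimer.ext ?_)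
  ext e'
  rw [hall e']
  exact ⟨fun _ => hcon N, fun _ => hcon M⟩

theorem PropertyStar.isBridgeless [Fintype E] (hG : G.PropertyStar) [Nontrivial G.Dimer] :
    G.IsBridgeless where
  connected := hG.connected
  exists_edge := exists_edge_of_nonempty_dimer
  exists_flow := fun e => by
    classical
    obtain ⟨M, hM⟩ := hG.edge_mem_dimer e
    obtain ⟨N, hN⟩ := hG.exists_notMem e
    refine ⟨fun e => (if e ∈ M.edges then 1 else 0) - (if e ∈ N.edges then 1 else 0), ?_,
      by simp [hM, hN]⟩
    convert dimerFlow_mem M N using 1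
    ext e'
    simp only [dimerFlow, Pi.sub_apply, edgeIndicator]
    push_cast
    rfl

theorem height_eq_relHeight [Fintype E] [Nonempty G.Dimer] (M : G.Dimer) (f : G.Face) :
    (height M f : ℚ) = relHeight M G.zeroHat f.point :=
  heightAt_eq M (f.notMem_drawing f.point_mem)

theorem heightAt_eq_height [Fintype E] [Nonempty G.Dimer] (M : G.Dimer) (f : G.Face) {p : ℂ}
    (hp : p ∈ f.1) : heightAt M p = height M f := by
  have h1 := heightAt_eq M (f.notMem_drawing hp)
  have h2 := height_eq_relHeight M f
  rw [← relHeight_eq_of_mem M _ f hp f.point_mem, relHeight, ← h1] at h2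
  exact_mod_cast h2.symm

theorem mrk_eq [Fintype E] [Nonempty G.Dimer] {M : G.Dimer} {x : MvPolynomial G.Face ℤ}
    (h1 : Nonempty (SaturatedChain G.zeroHat M))
    (h2 : ∀ C : SaturatedChain G.zeroHat M, C.weight = x) : mrk M = x := by
  rw [mrk, dif_pos h1, h2]

theorem height_of_subsingleton [Fintype E] [Nonempty G.Dimer] [Subsingleton G.Dimer] (M : G.Dimer) :
    height M = 0 := by
  ext f
  have h1 := height_eq_relHeight M f
  rw [Subsingleton.elim G.zeroHat M, relHeight, dimerFlow_self] at h1
  simp only [winding, Pi.zero_apply, zero_mul, Finset.sum_const_zero, neg_zero] at h1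
  exact_mod_cast h1

theorem weight_of_subsingleton [Subsingleton G.Dimer] {A B : G.Dimer} (C : SaturatedChain A B) :
    C.weight = 1 := by
  have : IsEmpty (Fin C.length) := ⟨fun i => (C.covBy i).ne (Subsingleton.elim _ _)⟩
  exact Finset.prod_of_isEmpty _

theorem isBot_zeroHat_of_eq [Nonempty G.Dimer] {Z : G.Dimer} (hZ : IsBot Z)
    (huniq : ∀ Z' : G.Dimer, IsBot Z' → Z' = Z) : G.zeroHat = Z :=
  huniq _ (Classical.epsilon_spec (p := fun Z : G.Dimer => IsBot Z) ⟨Z, hZ⟩)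

end BipartitePlaneGraph

theorem theorem2 {V E : Type*} [Fintype V] [Fintype E] (G : BipartitePlaneGraph V E)
    (hG : G.PropertyStar) [Nonempty G.Dimer] :
    -- `0̂` is the unique least element of the set of dimers
    (IsBot G.zeroHat ∧ ∀ Z : G.Dimer, IsBot Z → Z = G.zeroHat) ∧
    (∀ M : G.Dimer,
      -- the height at a face does not depend on the point of the face
      (∀ (f : G.Face), ∀ p ∈ f.1, BipartitePlaneGraph.heightAt M p =
        BipartitePlaneGraph.height M f) ∧
      -- the height vector has nonnegative coordinates, finitely many of which are nonzero
      (∀ f : G.Face, 0 ≤ BipartitePlaneGraph.height M f) ∧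
      (Function.support (BipartitePlaneGraph.height M)).Finite ∧
      -- there are saturated chains from `0̂` to `M`, and each of them has the weight `y ^ ht(M)`
      Nonempty (BipartitePlaneGraph.SaturatedChain G.zeroHat M) ∧
      (∀ C : BipartitePlaneGraph.SaturatedChain G.zeroHat M,
        C.weight = G.monomialOf (BipartitePlaneGraph.height M)) ∧
      BipartitePlaneGraph.mrk M = G.monomialOf (BipartitePlaneGraph.height M)) ∧
    G.dimerFacePolynomial =
      ∑ M : G.Dimer, G.monomialOf (BipartitePlaneGraph.height M) := by
  classical
  suffices key : (IsBot G.zeroHat ∧ ∀ Z : G.Dimer, IsBot Z → Z = G.zeroHat) ∧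
      ∀ M : G.Dimer, (∀ f : G.Face, 0 ≤ BipartitePlaneGraph.height M f) ∧
        (Function.support (BipartitePlaneGraph.height M)).Finite ∧
        Nonempty (BipartitePlaneGraph.SaturatedChain G.zeroHat M) ∧
        ∀ C : BipartitePlaneGraph.SaturatedChain G.zeroHat M,
          C.weight = G.monomialOf (BipartitePlaneGraph.height M) by
    have hmrk : ∀ M : G.Dimer, BipartitePlaneGraph.mrk M =
        G.monomialOf (BipartitePlaneGraph.height M) := fun M =>
      BipartitePlaneGraph.mrk_eq (key.2 M).2.2.1 (key.2 M).2.2.2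
    refine ⟨key.1, fun M => ⟨fun f p hp => BipartitePlaneGraph.heightAt_eq_height M f hp,
      (key.2 M).1, (key.2 M).2.1, (key.2 M).2.2.1, (key.2 M).2.2.2, hmrk M⟩, ?_⟩
    exact Finset.sum_congr rfl fun M _ => hmrk M
  rcases subsingleton_or_nontrivial G.Dimer with hs | hn
  · refine ⟨⟨fun M => (Subsingleton.elim _ _ : G.zeroHat = M) ▸ le_rfl,
      fun Z _ => Subsingleton.elim _ _⟩, fun M => ?_⟩
    rw [BipartitePlaneGraph.height_of_subsingleton M]
    refine ⟨fun f => le_rfl, by simp, ?_, fun C => ?_⟩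
    · rw [Subsingleton.elim G.zeroHat M]
      exact ⟨BipartitePlaneGraph.SaturatedChain.refl M⟩
    · rw [BipartitePlaneGraph.weight_of_subsingleton]
      simp [BipartitePlaneGraph.monomialOf]
  · have h := hG.isBridgeless
    obtain ⟨Z, hZ, hflip, hpos⟩ := h.exists_isBot hG.edge_mem_dimer hG.exists_notMem
    have huniq : ∀ Z' : G.Dimer, IsBot Z' → Z' = Z := fun Z' hZ' => by
      rcases (hZ' Z).cases_head with h1 | ⟨M', ⟨f, hf⟩, -⟩
      · exact h1.symm
      · exact absurd hf (hflip f M')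
    have h0 := BipartitePlaneGraph.isBot_zeroHat_of_eq hZ huniq
    have := h.finite_face
    refine ⟨⟨h0 ▸ hZ, fun Z' hZ' => (huniq Z' hZ').trans h0.symm⟩, fun M => ⟨fun f => ?_,
      Set.toFinite _, ?_, fun C => ?_⟩⟩
    · have h1 := BipartitePlaneGraph.height_eq_relHeight M f
      rw [h0] at h1
      have h2 := hpos M f
      rw [← h1] at h2
      exact_mod_cast h2
    · exact h.nonempty_saturatedChain (h0 ▸ hZ M)
    · exact h.weight_eq_monomialOf C fun f => BipartitePlaneGraph.height_eq_relHeight M f
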